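/- All graphs are finite and simple. For $s\ge 1$, let $sP_2$ be the disjoint union of $s$ copies of the path $P_2$ on two vertices; a graph is $sP_2$-free if it has no induced subgraph isomorphic to $sP_2$. An odd cycle transversal of a graph $G=(V,E)$ is a set $S\subseteq V$ such that $G-S$ has no induced subgraph isomorphic to one of the cycles $C_3,C_5,C_7,\dots$ (equivalently, $G-S$ is bipartite); it is connected if it induces a connected (in particular nonempty) subgraph of $G$. The problem Odd Cycle Transversal (respectively Connected Odd Cycle Transversal) asks, for a given graph $G$ and an integer $k\ge 0$, whether $G$ has an odd cycle transversal (respectively a connected odd cycle transversal) $S$ with $|S|\le k$. **Theorem.** For every constant $s\ge 1$, Odd Cycle Transversal and Connected Odd Cycle Transversal can be solved in polynomial time for $sP_2$-free graphs. That is, for each of the two problems and each $s\ge1$ there are a random access machine program (unit cost; addition and truncated subtraction of natural numbers, but no multiplication) and a polynomial $b$ such that, for every $sP_2$-free graph $G$ on $n$ vertices, given by its adjacency matrix, and every integer $k\ge 0$, the program halts on the input $(G,k)$ after at most $b(n)$ steps and answers the question correctly. -/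

import Mathlib

open SimpleGraph

/-! ### Random access machine programs with a step count -/

namespace RAM

/-- Arithmetic expressions over variables and arrays of natural numbers. Variables and arrays are named
by natural numbers; the available operations are reading, addition and truncated subtraction. There
is no multiplication, so values have a bit length that grows at most linearly with the running time
and unit cost is polynomially related to the cost on a Turing machine. -/
inductive Expr where
  /-- a constant -/
  | lit (c : ℕ)
  /-- the value of the variable `x` -/
  | var (x : ℕ)
  /-- the entry of the array `a` at the index given by `i` -/
  | get (a : ℕ) (i : Expr)
  /-- addition -/
  | add (e f : Expr)
  /-- truncated subtraction -/
  | sub (e f : Expr)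

/-- Programs. A program is a finite object, so it mentions finitely many variables, arrays and
constants. A test succeeds when its expression has a nonzero value. -/
inductive Prog where
  /-- do nothing -/
  | skip
  /-- `x := e` -/
  | assign (x : ℕ) (e : Expr)
  /-- `a[i] := e` -/
  | store (a : ℕ) (i e : Expr)
  /-- run `p`, then `q` -/
  | seq (p q : Prog)
  /-- if `e ≠ 0` then `p` else `q` -/
  | branch (e : Expr) (p q : Prog)
  /-- while `e ≠ 0` do `p` -/
  | loop (e : Expr) (p : Prog)

/-- The memory: the values of the variables and the contents of the arrays. -/
@[ext]
structure Memory where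
  /-- the values of the variables -/
  var : ℕ → ℕ
  /-- the contents of the arrays -/
  arr : ℕ → ℕ → ℕ

/-- The value of an expression. -/
def Expr.eval (σ : Memory) : Expr → ℕ
  | .lit c => c
  | .var x => σ.var x
  | .get a i => σ.arr a (i.eval σ)
  | .add e f => e.eval σ + f.eval σ
  | .sub e f => e.eval σ - f.eval σ

/-- The number of elementary operations that it takes to evaluate an expression. -/
def Expr.cost : Expr → ℕ
  | .lit _ => 1
  | .var _ => 1
  | .get _ i => i.cost + 1
  | .add e f => e.cost + f.cost + 1
  | .sub e f => e.cost + f.cost + 1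

/-- The memory after writing `v` to the variable `x`. -/
def Memory.setVar (σ : Memory) (x v : ℕ) : Memory :=
  { σ with var := Function.update σ.var x v }

/-- The memory after writing `v` to the entry `i` of the array `a`. -/
def Memory.setArr (σ : Memory) (a i v : ℕ) : Memory :=
  { σ with arr := Function.update σ.arr a (Function.update (σ.arr a) i v) }

/-- `Runs p σ t τ`: started in the memory `σ`, the program `p` halts after exactly `t` elementary
steps, in the memory `τ`. -/
inductive Runs : Prog → Memory → ℕ → Memory → Prop where
  | skip (σ : Memory) : Runs .skip σ 1 σ
  | assign (x : ℕ) (e : Expr) (σ : Memory) :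
      Runs (.assign x e) σ (e.cost + 1) (σ.setVar x (e.eval σ))
  | store (a : ℕ) (i e : Expr) (σ : Memory) :
      Runs (.store a i e) σ (i.cost + e.cost + 1) (σ.setArr a (i.eval σ) (e.eval σ))
  | seq {p q : Prog} {σ τ υ : Memory} {t u : ℕ} :
      Runs p σ t τ → Runs q τ u υ → Runs (.seq p q) σ (t + u) υ
  | branch_true {e : Expr} {p q : Prog} {σ τ : Memory} {t : ℕ} :
      e.eval σ ≠ 0 → Runs p σ t τ → Runs (.branch e p q) σ (e.cost + 1 + t) τ
  | branch_false {e : Expr} {p q : Prog} {σ τ : Memory} {t : ℕ} :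
      e.eval σ = 0 → Runs q σ t τ → Runs (.branch e p q) σ (e.cost + 1 + t) τ
  | loop_true {e : Expr} {p : Prog} {σ τ υ : Memory} {t u : ℕ} :
      e.eval σ ≠ 0 → Runs p σ t τ → Runs (.loop e p) τ u υ →
        Runs (.loop e p) σ (e.cost + 1 + t + u) υ
  | loop_false {e : Expr} {p : Prog} {σ : Memory} :
      e.eval σ = 0 → Runs (.loop e p) σ (e.cost + 1) σ

open Classical in
/-- The input memory for a graph `G` with vertices `0, …, n - 1` and a number `k`: variable `0` holds
`n`, variable `1` holds `k`, array `0` holds the adjacency matrix of `G`, row by row; everything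
else is zero. -/
noncomputable def inputMemory {n : ℕ} (G : SimpleGraph (Fin n)) (k : ℕ) : Memory where
  var x := if x = 0 then n else if x = 1 then k else 0
  arr a m := if a = 0 ∧ ∃ i j : Fin n, m = (i : ℕ) * n + (j : ℕ) ∧ G.Adj i j then 1 else 0

/-- The decision problem `Q` (input: a graph `G` and a number `k`) is solvable in polynomial time on
the graphs in the class `C`: one program, on every input with `G` in `C`, halts within a number of
steps that is polynomial in the number of vertices of `G`, and its output (variable `0`) is nonzero
exactly for the yes-instances. -/
def PolyTimeSolvableOn (C : ∀ n : ℕ, SimpleGraph (Fin n) → Prop)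
    (Q : ∀ n : ℕ, SimpleGraph (Fin n) → ℕ → Prop) : Prop :=
  ∃ (p : Prog) (b : Polynomial ℕ), ∀ (n : ℕ) (G : SimpleGraph (Fin n)) (k : ℕ), C n G →
    ∃ (t : ℕ) (τ : Memory), Runs p (inputMemory G k) t τ ∧ t ≤ b.eval n ∧ (τ.var 0 ≠ 0 ↔ Q n G k)

end RAM

/-! ### Graphs -/

/-- The disjoint union of `s` copies of the graph `H`. -/
def disjointCopies {W : Type*} (s : ℕ) (H : SimpleGraph W) : SimpleGraph (Fin s × W) where
  Adj x y := x.1 = y.1 ∧ H.Adj x.2 y.2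
  symm := ⟨fun _ _ h => ⟨h.1.symm, h.2.symm⟩⟩
  loopless := ⟨fun _ h => H.irrefl h.2⟩

/-- `G` has no induced subgraph isomorphic to the disjoint union of `s` paths on two vertices. -/
def IsSP2Free {V : Type*} (s : ℕ) (G : SimpleGraph V) : Prop :=
  ¬ disjointCopies s (pathGraph 2) ⊴ G

/-- `S` is an odd cycle transversal of `G`: the graph `G - S` has no induced subgraph isomorphic to
one of the cycles on `3, 5, 7, …` vertices. -/
def IsOddCycleTransversal {V : Type*} (G : SimpleGraph V) (S : Finset V) : Prop :=
  ∀ m : ℕ, 1 ≤ m → ¬ cycleGraph (2 * m + 1) ⊴ G.induce {v | v ∉ S}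

/-- The question of Odd Cycle Transversal: is there one with at most `k` vertices? -/
def OddCycleTransversal (n : ℕ) (G : SimpleGraph (Fin n)) (k : ℕ) : Prop :=
  ∃ S : Finset (Fin n), IsOddCycleTransversal G S ∧ S.card ≤ k

/-- The question of Connected Odd Cycle Transversal: is there one with at most `k` vertices that
induces a connected (in particular nonempty) subgraph? -/
def ConnectedOddCycleTransversal (n : ℕ) (G : SimpleGraph (Fin n)) (k : ℕ) : Prop :=
  ∃ S : Finset (Fin n), IsOddCycleTransversal G S ∧ (G.induce {v | v ∈ S}).Connected ∧ S.card ≤ k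

/-! ### Memory transformations computable in polynomial time -/

namespace RAM

/-! A set `S` is an odd cycle transversal exactly when two independent sets cover the rest of the
graph. Both can be enlarged to maximal independent sets `I`, `J` of the whole graph, and the
complement of `I ∪ J` is then a transversal contained in `S`. Hence it suffices to search over pairs
of maximal independent sets.

The heart is `exists_conflict_list`: in an `sP₂`-free graph a maximal independent set `I` is encoded
by fewer than `s` pairs of vertices. Scan the vertices in order and take each one without a smaller
taken neighbour. This reproduces `I` unless some `u ∉ I` has its first neighbour `v ∈ I` after it.
Choose such a pair with `v` largest, forbid below `v` the vertex `u` and all neighbours of `u` and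
`v`, and recurse on the vertices below `v` that remain. The pairs found form an induced matching, so
there are fewer than `s` of them. Conversely the scan returns an independent set for any list of
pairs, so no guess gives a false yes.

For the connected problem let `X` be a connected transversal containing the complement `S` of `I ∪
J`. By maximality every vertex of `S` has a neighbour in `I`. Representatives of the components of
`G[S]` are independent and are dominated by fewer than `s` vertices of `I`
(`exists_dominating_finset`). Shortest paths have fewer than `3s` edges, so `3s²` vertices connect
`S` (`exists_connecting_finset`). If `X \ S` has fewer elements than this connecting set, it serves
instead; either way at most `3s²` vertices are added and the size of `X` is not exceeded.

The program runs over all values of a constant number of vertex variables, computes the two greedy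
sets and tests the size, and for the second problem connectivity. `PolyComputes` pairs a memory
function with a program, a time bound and a frame condition; it is closed under composition, tests
and bounded loops, so that correctness reduces to loop invariants. -/

@[simp] theorem Memory.setVar_var (σ : Memory) (x v y : ℕ) :
    (σ.setVar x v).var y = if y = x then v else σ.var y := by
  simp [Memory.setVar, Function.update_apply]

@[simp] theorem Memory.setVar_arr (σ : Memory) (x v : ℕ) : (σ.setVar x v).arr = σ.arr := rfl

@[simp] theorem Memory.setArr_var (σ : Memory) (a i v : ℕ) : (σ.setArr a i v).var = σ.var := rfl

@[simp] theorem Memory.setArr_arr (σ : Memory) (a i v b j : ℕ) :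
    (σ.setArr a i v).arr b j = if b = a ∧ j = i then v else σ.arr b j := by
  simp only [Memory.setArr, Function.update_apply]
  split_ifs <;> simp_all

/-- `f` is computed by a program that runs in time polynomial in the value of variable `0` and that
writes only to the variables in `X` and to the arrays in `Y`. -/
structure PolyComputes (X Y : Set ℕ) (f : Memory → Memory) : Prop where
  runs : ∃ (p : Prog) (b : Polynomial ℕ), ∀ σ, ∃ t, Runs p σ t (f σ) ∧ t ≤ b.eval (σ.var 0)
  var_eq : ∀ σ x, x ∉ X → (f σ).var x = σ.var x
  arr_eq : ∀ σ a, a ∉ Y → (f σ).arr a = σ.arr a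

theorem PolyComputes.mono {X Y X' Y' : Set ℕ} {f : Memory → Memory} (h : PolyComputes X Y f)
    (hX : X ⊆ X') (hY : Y ⊆ Y') : PolyComputes X' Y' f :=
  ⟨h.runs, fun σ x hx => h.var_eq σ x fun h' => hx (hX h'),
    fun σ a ha => h.arr_eq σ a fun h' => ha (hY h')⟩

theorem polyComputes_id : PolyComputes ∅ ∅ id :=
  ⟨⟨.skip, 1, fun σ => ⟨1, .skip σ, by simp⟩⟩, fun _ _ _ => rfl, fun _ _ _ => rfl⟩

/-- The effect of `x := e`. -/
def assignF (x : ℕ) (e : Expr) (σ : Memory) : Memory := σ.setVar x (e.eval σ)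

/-- The effect of `a[i] := e`. -/
def storeF (a : ℕ) (i e : Expr) (σ : Memory) : Memory := σ.setArr a (i.eval σ) (e.eval σ)

/-- The effect of running `f` if `e ≠ 0`. -/
def whenF (e : Expr) (f : Memory → Memory) (σ : Memory) : Memory :=
  if e.eval σ = 0 then σ else f σ

/-- The effect of running `f` with `i = 0, …, n - 1`, where `n` is the value of variable `0`. -/
def forF (i : ℕ) (f : Memory → Memory) (σ : Memory) : Memory :=
  (fun τ => (f τ).setVar i ((f τ).var i + 1))^[σ.var 0] (σ.setVar i 0)

theorem polyComputes_assignF (x : ℕ) (e : Expr) : PolyComputes {x} ∅ (assignF x e) where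
  runs := ⟨.assign x e, Polynomial.C (e.cost + 1), fun σ => ⟨_, .assign x e σ, by simp⟩⟩
  var_eq σ y hy := by simp_all [assignF]
  arr_eq σ a _ := rfl

theorem polyComputes_storeF (a : ℕ) (i e : Expr) : PolyComputes ∅ {a} (storeF a i e) where
  runs := ⟨.store a i e, Polynomial.C (i.cost + e.cost + 1), fun σ => ⟨_, .store a i e σ, by simp⟩⟩
  var_eq σ y _ := rfl
  arr_eq σ b hb := by
    ext j
    simp_all [storeF]

variable {X Y : Set ℕ} {f g : Memory → Memory}

/-- Both time bounds are polynomials in variable `0`, so they can be added because `f` leaves this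
variable alone. This is the purpose of `0 ∉ X`. -/
theorem PolyComputes.comp (hg : PolyComputes X Y g) (hf : PolyComputes X Y f) (h0 : 0 ∉ X) :
    PolyComputes X Y (fun σ => g (f σ)) where
  runs := by
    obtain ⟨p, b, hp⟩ := hf.runs
    obtain ⟨q, c, hq⟩ := hg.runs
    refine ⟨.seq p q, b + c, fun σ => ?_⟩
    obtain ⟨t, ht, htb⟩ := hp σ
    obtain ⟨u, hu, huc⟩ := hq (f σ)
    rw [hf.var_eq σ 0 h0] at huc
    exact ⟨t + u, .seq ht hu, by rw [Polynomial.eval_add]; lia⟩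
  var_eq σ x hx := by rw [hg.var_eq _ x hx, hf.var_eq _ x hx]
  arr_eq σ x hx := by rw [hg.arr_eq _ x hx, hf.arr_eq _ x hx]

theorem PolyComputes.whenF (hf : PolyComputes X Y f) (e : Expr) : PolyComputes X Y (whenF e f) where
  runs := by
    obtain ⟨p, b, hp⟩ := hf.runs
    refine ⟨.branch e p .skip, Polynomial.C (e.cost + 2) + b, fun σ => ?_⟩
    rw [Polynomial.eval_add, Polynomial.eval_C]
    by_cases h : e.eval σ = 0
    · exact ⟨_, .branch_false h (by simpa [RAM.whenF, h] using .skip σ), by lia⟩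
    · obtain ⟨t, ht, htb⟩ := hp σ
      exact ⟨_, .branch_true h (by simpa [RAM.whenF, h] using ht), by lia⟩
  var_eq σ x hx := by
    rw [RAM.whenF]
    split_ifs
    · rfl
    · exact hf.var_eq σ x hx
  arr_eq σ x hx := by
    rw [RAM.whenF]
    split_ifs
    · rfl
    · exact hf.arr_eq σ x hx

/-- The invariant rule for `forF`, with the values that the loop does not change at hand. -/
theorem PolyComputes.forF_induction (hf : PolyComputes X Y f) {i : ℕ} (hi : i ∉ X)
    (P : ℕ → Memory → Prop) {σ : Memory} (h0 : P 0 (σ.setVar i 0))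
    (hs : ∀ j τ, j < σ.var 0 → τ.var i = j → (∀ x, x ∉ X → x ≠ i → τ.var x = σ.var x) →
      (∀ a, a ∉ Y → τ.arr a = σ.arr a) → P j τ → P (j + 1) ((f τ).setVar i (j + 1))) :
    P (σ.var 0) (forF i f σ) := by
  have key : ∀ j ≤ σ.var 0,
      let τ := (fun τ => (f τ).setVar i ((f τ).var i + 1))^[j] (σ.setVar i 0)
      τ.var i = j ∧ (∀ x, x ∉ X → x ≠ i → τ.var x = σ.var x) ∧
        (∀ a, a ∉ Y → τ.arr a = σ.arr a) ∧ P j τ := by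
    intro j
    induction j with
    | zero => exact fun _ => ⟨by simp, fun x _ h => by simp [h], fun a _ => rfl, h0⟩
    | succ j ih =>
      intro hj
      obtain ⟨h1, h2, h3, h4⟩ := ih (by lia)
      rw [Function.iterate_succ_apply']
      generalize (fun τ => (f τ).setVar i ((f τ).var i + 1))^[j] (σ.setVar i 0) = τ at *
      have hv : (f τ).var i = j := by rw [hf.var_eq τ i hi, h1]
      refine ⟨by simp [hv], fun x hx hxi => ?_, fun a ha => ?_, ?_⟩
      · simp [hxi, hf.var_eq τ x hx, h2 x hx hxi]
      · simp [hf.arr_eq τ a ha, h3 a ha]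
      · simpa [hv] using hs j τ (by lia) h1 h2 h3 h4
  exact (key _ le_rfl).2.2.2

theorem PolyComputes.forF (hf : PolyComputes X Y f) (h0 : 0 ∉ X) {i : ℕ} (hi : i ∉ X)
    (hi0 : i ≠ 0) : PolyComputes (insert i X) Y (forF i f) where
  runs := by
    obtain ⟨p, b, hp⟩ := hf.runs
    let q : Prog := .seq p (.assign i (.add (.var i) (.lit 1)))
    let e : Expr := .sub (.var 0) (.var i)
    -- Initialisation costs 2 and the last, failing test 4, which gives 6. On top of the body each
    -- round pays 4 for its test and 4 for the increment, which gives 8.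
    refine ⟨.seq (.assign i (.lit 0)) (.loop e q),
      Polynomial.C 6 + Polynomial.X * (b + Polynomial.C 8), fun σ => ?_⟩
    have key : ∀ m σ, σ.var 0 = σ.var i + m → ∃ t, Runs (.loop e q) σ t
        ((fun τ => (f τ).setVar i ((f τ).var i + 1))^[m] σ) ∧ t ≤ 4 + m * (b.eval (σ.var 0) + 8) := by
      intro m
      induction m with
      | zero => exact fun σ h => ⟨_, .loop_false (by simp [e, Expr.eval, h]), by simp [e, Expr.cost]⟩
      | succ m ih =>
        intro σ h
        obtain ⟨t, ht, htb⟩ := hp σ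
        have hz := hf.var_eq σ 0 h0
        have hv := hf.var_eq σ i hi
        obtain ⟨u, hu, hub⟩ := ih ((f σ).setVar i ((f σ).var i + 1)) (by
          simp [hi0.symm, hz, hv]; lia)
        have h1 : Runs (.assign i (.add (.var i) (.lit 1))) (f σ) 4
            ((f σ).setVar i ((f σ).var i + 1)) := .assign i (.add (.var i) (.lit 1)) (f σ)
        have h2 := Runs.loop_true (e := e) (σ := σ) (by simp [e, Expr.eval]; lia) (.seq ht h1) hu
        refine ⟨_, h2, ?_⟩
        simp only [Memory.setVar_var, hi0.symm, if_false, hz] at hub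
        have : e.cost = 3 := rfl
        rw [this, add_mul]
        lia
    obtain ⟨t, ht, htb⟩ := key (σ.var 0) (σ.setVar i 0) (by simp [hi0.symm])
    refine ⟨_, .seq (.assign i (.lit 0) σ) ht, ?_⟩
    simp [Expr.cost, hi0.symm] at htb ⊢
    lia
  var_eq σ x hx := by
    rw [Set.mem_insert_iff, not_or] at hx
    exact hf.forF_induction hi (fun _ τ => τ.var x = σ.var x) (by simp [hx.1])
      (fun j τ _ _ _ _ h => by simp [hx.1, hf.var_eq τ x hx.2, h])
  arr_eq σ a ha :=
    hf.forF_induction hi (fun _ τ => τ.arr a = σ.arr a) (by simp)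
      (fun j τ _ _ _ _ h => by simp [hf.arr_eq τ a ha, h])

/-- The composition of the functions `f c` for `c` in a list. -/
def listF {ι : Type*} (f : ι → Memory → Memory) (l : List ι) (σ : Memory) : Memory :=
  l.foldl (fun τ c => f c τ) σ

theorem polyComputes_listF {ι : Type*} {f : ι → Memory → Memory} (hf : ∀ c, PolyComputes X Y (f c))
    (h0 : 0 ∉ X) (l : List ι) : PolyComputes X Y (listF f l) := by
  induction l with
  | nil => exact polyComputes_id.mono (Set.empty_subset _) (Set.empty_subset _)
  | cons c l ih => exact ih.comp (hf c) h0

end RAM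

/-! ### Access to the adjacency matrix -/

namespace RAM

/-- The entry of the adjacency matrix in row `x` and column `y`. -/
def adjE (x y : Expr) : Expr := .get 0 (.add (.get 1 x) y)

/-- The memory holds a graph on `0, …, n - 1` with adjacency relation `A`, and the number `k`. -/
structure Holds (A : ℕ → ℕ → Prop) (n k : ℕ) (σ : Memory) : Prop where
  var_zero : σ.var 0 = n
  var_one : σ.var 1 = k
  adj : ∀ i < n, ∀ j < n, σ.arr 0 (σ.arr 1 i + j) ≠ 0 ↔ A i j

variable {A : ℕ → ℕ → Prop} {n k : ℕ} {σ τ : Memory}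

theorem Holds.congr (h : Holds A n k σ) (h0 : τ.var 0 = σ.var 0) (h1 : τ.var 1 = σ.var 1)
    (h2 : τ.arr 0 = σ.arr 0) (h3 : τ.arr 1 = σ.arr 1) : Holds A n k τ :=
  ⟨h0.trans h.var_zero, h1.trans h.var_one, by rw [h2, h3]; exact h.adj⟩

theorem Holds.adjE_eval (h : Holds A n k σ) {x y : Expr} (hx : x.eval σ < n) (hy : y.eval σ < n) :
    (adjE x y).eval σ = 0 ↔ ¬ A (x.eval σ) (y.eval σ) := by
  rw [← h.adj _ hx _ hy, not_not]
  rfl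

/-! ### Greedy independent sets -/

/-- The vertex `x` is in conflict with the edge `uv`. -/
def Conflict (A : ℕ → ℕ → Prop) (x u v : ℕ) : Prop :=
  x < v ∧ (x = u ∨ A x u ∨ A x v)

/-- Set `a[x]` to `0` if the vertex in variable `3` is in conflict with the vertices in the variables
`c.1` and `c.2`. -/
def conflictF (a : ℕ) (c : ℕ × ℕ) : Memory → Memory :=
  whenF (.sub (.var c.2) (.var 3)) (whenF
    -- With truncated subtraction, `(x - u) + (u - x)` is the distance of `x` and `u`, so the first
    -- summand is nonzero exactly for `x = u`. Addition acts as disjunction.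
    (.add (.sub (.lit 1) (.add (.sub (.var 3) (.var c.1)) (.sub (.var c.1) (.var 3))))
      (.add (adjE (.var 3) (.var c.1)) (adjE (.var 3) (.var c.2))))
    (storeF a (.var 3) (.lit 0)))

/-- Set `a[x]` to `0` if the vertex in variable `3` has a smaller neighbour in `a`. -/
def smallerNeighborF (a : ℕ) : Memory → Memory :=
  forF 4 (whenF (.sub (.var 3) (.var 4)) (whenF (.get a (.var 4))
    (whenF (adjE (.var 4) (.var 3)) (storeF a (.var 3) (.lit 0)))))

/-- Compute in `a` the greedy independent set of the vertices without conflicts. -/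
def greedyF (a : ℕ) (l : List (ℕ × ℕ)) : Memory → Memory :=
  forF 3 (fun σ => listF (conflictF a) l (smallerNeighborF a (storeF a (.var 3) (.lit 1) σ)))

theorem polyComputes_conflictF (a : ℕ) (c : ℕ × ℕ) : PolyComputes ∅ {a} (conflictF a c) :=
  ((polyComputes_storeF _ _ _).whenF _).whenF _

theorem polyComputes_smallerNeighborF (a : ℕ) : PolyComputes {4} {a} (smallerNeighborF a) := by
  rw [← insert_empty_eq]
  exact ((((polyComputes_storeF _ _ _).whenF _).whenF _).whenF _).forF (by simp) (by simp) (by simp)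

theorem polyComputes_greedyF (a : ℕ) (l : List (ℕ × ℕ)) :
    PolyComputes {3, 4} {a} (greedyF a l) :=
  PolyComputes.forF (((polyComputes_listF (polyComputes_conflictF a) (by simp) l).mono
    (by simp) (by simp)).comp ((polyComputes_smallerNeighborF a).comp
      ((polyComputes_storeF _ _ _).mono (by simp) (by simp)) (by simp)) (by simp))
    (by simp) (by simp) (by simp)

theorem Holds.conflictF_arr (h : Holds A n k σ) {a : ℕ} {c : ℕ × ℕ} (h3 : σ.var 3 < n)
    (h1 : σ.var c.1 < n) (h2 : σ.var c.2 < n) (z : ℕ) : (conflictF a c σ).arr a z ≠ 0 ↔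
      σ.arr a z ≠ 0 ∧ (z = σ.var 3 → ¬ Conflict A z (σ.var c.1) (σ.var c.2)) := by
  have e1 := h.adjE_eval (x := .var 3) (y := .var c.1) h3 h1
  have e2 := h.adjE_eval (x := .var 3) (y := .var c.2) h3 h2
  simp only [Expr.eval] at e1 e2
  have e3 : 1 ≤ σ.var 3 - σ.var c.1 + (σ.var c.1 - σ.var 3) ↔ ¬ σ.var 3 = σ.var c.1 := by lia
  simp only [conflictF, whenF, Conflict]
  split_ifs with h5 h6
  · simp only [Expr.eval] at h5
    exact ⟨fun h => ⟨h, fun hz h => by lia⟩, fun h => h.1⟩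
  · simp only [Expr.eval, Nat.add_eq_zero_iff, e1, e2, Nat.sub_eq_zero_iff_le, e3] at h6
    exact ⟨fun h => ⟨h, fun hz h => by subst hz; tauto⟩, fun h => h.1⟩
  · simp only [Expr.eval, Nat.add_eq_zero_iff, e1, e2, Nat.sub_eq_zero_iff_le, e3] at h5 h6
    rw [storeF, Memory.setArr_arr]
    by_cases hz : z = σ.var 3
    · subst hz
      simp only [Expr.eval, and_self, if_true, ne_eq, not_true, false_iff, not_and]
      intro _ h
      exact h trivial (by lia) (by tauto)
    · simp [hz, Expr.eval]

theorem Holds.listF_conflictF_arr {a : ℕ} (ha0 : a ≠ 0) (ha1 : a ≠ 1) (l : List (ℕ × ℕ)) :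
    ∀ {σ : Memory}, Holds A n k σ → σ.var 3 < n → (∀ c ∈ l, σ.var c.1 < n ∧ σ.var c.2 < n) →
      ∀ z, (listF (conflictF a) l σ).arr a z ≠ 0 ↔
        σ.arr a z ≠ 0 ∧ (z = σ.var 3 → ∀ c ∈ l, ¬ Conflict A z (σ.var c.1) (σ.var c.2)) := by
  induction l with
  | nil => simp [listF]
  | cons c l ih =>
    intro σ h h3 hl z
    have hv : ∀ x, (conflictF a c σ).var x = σ.var x := fun x =>
      (polyComputes_conflictF a c).var_eq σ x (by simp)
    have hr : ∀ b, b ≠ a → (conflictF a c σ).arr b = σ.arr b := fun b hb =>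
      (polyComputes_conflictF a c).arr_eq σ b hb
    have := ih (h.congr (hv 0) (hv 1) (hr 0 ha0.symm) (hr 1 ha1.symm)) (by rwa [hv])
      (fun d hd => by simpa only [hv] using hl d (by simp [hd])) z
    rw [show listF (conflictF a) (c :: l) σ = listF (conflictF a) l (conflictF a c σ) from rfl,
      this, h.conflictF_arr h3 (hl c (by simp)).1 (hl c (by simp)).2]
    simp only [hv, List.forall_mem_cons]
    tauto

theorem Holds.smallerNeighborF_arr (h : Holds A n k σ) {a : ℕ} (ha0 : a ≠ 0) (ha1 : a ≠ 1)
    (h3 : σ.var 3 < n) (z : ℕ) : (smallerNeighborF a σ).arr a z ≠ 0 ↔ σ.arr a z ≠ 0 ∧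
      (z = σ.var 3 → ∀ y < z, σ.arr a y ≠ 0 → ¬ A y z) := by
  have key := PolyComputes.forF_induction (f := whenF (.sub (.var 3) (.var 4))
    (whenF (.get a (.var 4)) (whenF (adjE (.var 4) (.var 3)) (storeF a (.var 3) (.lit 0)))))
    (((((polyComputes_storeF _ _ _).whenF _).whenF _).whenF _)) (i := 4) (by simp)
    (fun j τ => ∀ z, τ.arr a z ≠ 0 ↔ σ.arr a z ≠ 0 ∧
      (z = σ.var 3 → ∀ y < j, y < z → σ.arr a y ≠ 0 → ¬ A y z)) (σ := σ) (by simp) ?_ z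
  · rw [smallerNeighborF, key]
    refine and_congr_right fun _ => forall_congr' fun hz => ?_
    have := h.var_zero
    exact ⟨fun H y hy => H y (by lia) hy, fun H y _ hy => H y hy⟩
  · intro j τ hj hτ hv hr H z
    have hx : τ.var 3 = σ.var 3 := hv 3 (by simp) (by simp)
    have h' : Holds A n k τ := h.congr (hv 0 (by simp) (by simp)) (hv 1 (by simp) (by simp))
      (hr 0 ha0.symm) (hr 1 ha1.symm)
    rw [h.var_zero] at hj
    have e := h'.adjE_eval (x := .var 4) (y := .var 3) (by simpa [Expr.eval, hτ])
      (by simpa [Expr.eval, hx])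
    simp only [Expr.eval, hτ, hx] at e
    have hcases : ∀ y, y < j + 1 ↔ y < j ∨ y = j := fun y => by lia
    -- The loop writes only the entry of the current vertex, so the smaller entries that it reads
    -- are still the original ones.
    have hjj : j < σ.var 3 → (τ.arr a j ≠ 0 ↔ σ.arr a j ≠ 0) := by
      intro hlt
      rw [H]
      exact ⟨fun h => h.1, fun h => ⟨h, fun h => by lia⟩⟩
    simp only [whenF, Expr.eval, hτ, hx, e, Memory.setVar_arr, storeF, hcases]
    have Hz := H z
    split_ifs with c1 c2 c3
    · rw [Hz]
      refine and_congr_right fun _ => forall_congr' fun hz => ?_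
      exact ⟨fun H y hy hyz => H y (by lia) hyz, fun H y hy hyz => H y (by lia) hyz⟩
    · rw [Hz]
      refine and_congr_right fun _ => forall_congr' fun hz => ?_
      refine ⟨fun H y hy hyz hs => ?_, fun H y hy hyz => H y (by lia) hyz⟩
      rcases hy with hy | rfl
      · exact H y hy hyz hs
      · exact absurd c2 ((hjj (by lia)).2 hs)
    · rw [Hz]
      refine and_congr_right fun _ => forall_congr' fun hz => ?_
      refine ⟨fun H y hy hyz hs => ?_, fun H y hy hyz => H y (by lia) hyz⟩
      rcases hy with hy | rfl
      · exact H y hy hyz hs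
      · rw [hz]
        exact e.1 c3
    · by_cases hz : z = σ.var 3
      · rw [e, not_not] at c3
        have hs := (hjj (by lia)).1 c2
        simp only [Memory.setArr_arr, hz, and_self, if_true, ne_eq, not_true, false_iff, not_and,
          true_imp_iff]
        exact fun _ H => H j (Or.inr rfl) (by lia) hs c3
      · simpa [hz] using Hz

/-- `I` is the greedy independent set of the vertices without conflicts with pairs in `l`. -/
def IsGreedy (A : ℕ → ℕ → Prop) (n : ℕ) (l : List (ℕ × ℕ)) (I : ℕ → Prop) : Prop :=
  ∀ x < n, I x ↔ (∀ y < x, I y → ¬ A y x) ∧ ∀ c ∈ l, ¬ Conflict A x c.1 c.2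

/-- An entry is final once its round is over, and a round consults smaller entries only. The pairs
must sit in variables above `4` because `3` and `4` are loop counters. -/
theorem Holds.isGreedy_greedyF (h : Holds A n k σ) {a : ℕ} (ha0 : a ≠ 0) (ha1 : a ≠ 1)
    (l : List (ℕ × ℕ)) (hl : ∀ c ∈ l, σ.var c.1 < n ∧ σ.var c.2 < n)
    (hl' : ∀ c ∈ l, 4 < c.1 ∧ 4 < c.2) :
    IsGreedy A n (l.map fun c => (σ.var c.1, σ.var c.2)) (fun x => (greedyF a l σ).arr a x ≠ 0) := by
  have key := PolyComputes.forF_induction (X := {4}) (Y := {a})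
    (f := fun σ => listF (conflictF a) l (smallerNeighborF a (storeF a (.var 3) (.lit 1) σ)))
    (((polyComputes_listF (polyComputes_conflictF a) (by simp) l).mono
    (by simp) (by simp)).comp ((polyComputes_smallerNeighborF a).comp
      ((polyComputes_storeF _ _ _).mono (by simp) (by simp)) (by simp)) (by simp)) (i := 3) (by simp)
    (fun j τ => ∀ x < j, τ.arr a x ≠ 0 ↔ (∀ y < x, τ.arr a y ≠ 0 → ¬ A y x) ∧
      ∀ c ∈ l, ¬ Conflict A x (σ.var c.1) (σ.var c.2)) (σ := σ) (by simp) ?_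
  · rw [h.var_zero] at key
    intro x hx
    rw [List.forall_mem_map]
    exact key x hx
  · intro j τ hj hτ hv hr H
    rw [h.var_zero] at hj
    simp only [Memory.setVar_arr]
    have h' : Holds A n k τ := h.congr (hv 0 (by simp) (by simp)) (hv 1 (by simp) (by simp))
      (hr 0 ha0.symm) (hr 1 ha1.symm)
    set τ₁ := storeF a (.var 3) (.lit 1) τ with hτ₁
    set τ₂ := smallerNeighborF a τ₁ with hτ₂
    have hv₁ : ∀ x, τ₁.var x = τ.var x := fun x => rfl
    have hv₂ : ∀ x, x ≠ 4 → τ₂.var x = τ.var x := fun x hx =>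
      (polyComputes_smallerNeighborF a).var_eq _ x hx
    have hr₁ : ∀ b, b ≠ a → τ₁.arr b = τ.arr b := fun b hb =>
      (polyComputes_storeF _ _ _).arr_eq _ b hb
    have hr₂ : ∀ b, b ≠ a → τ₂.arr b = τ.arr b := fun b hb =>
      ((polyComputes_smallerNeighborF a).arr_eq _ b hb).trans (hr₁ b hb)
    have H₁ : Holds A n k τ₁ := h'.congr rfl rfl (hr₁ 0 ha0.symm) (hr₁ 1 ha1.symm)
    have H₂ : Holds A n k τ₂ := h'.congr (hv₂ 0 (by simp)) (hv₂ 1 (by simp)) (hr₂ 0 ha0.symm)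
      (hr₂ 1 ha1.symm)
    have hv' : ∀ x, 4 < x → τ₂.var x = σ.var x := fun x hx =>
      (hv₂ x (by lia)).trans (hv x (by simp; lia) (by lia))
    have E : ∀ z, (listF (conflictF a) l τ₂).arr a z ≠ 0 ↔ if z = j then
        (∀ y < z, τ.arr a y ≠ 0 → ¬ A y z) ∧ ∀ c ∈ l, ¬ Conflict A z (σ.var c.1) (σ.var c.2)
        else τ.arr a z ≠ 0 := by
      intro z
      rw [H₂.listF_conflictF_arr ha0 ha1 l (by rw [hv₂ 3 (by simp), hτ]; exact hj)
        (fun c hc => by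
          rw [hv' _ (hl' c hc).1, hv' _ (hl' c hc).2]
          exact hl c hc), H₁.smallerNeighborF_arr ha0 ha1 (by rw [hv₁ 3, hτ]; exact hj), hv₁ 3,
        hv₂ 3 (by simp), hτ]
      have e1 : ∀ y, τ₁.arr a y = if y = j then 1 else τ.arr a y := by
        simp [hτ₁, storeF, Expr.eval, hτ]
      have e2 : ∀ c ∈ l, (¬ Conflict A z (τ₂.var c.1) (τ₂.var c.2) ↔
          ¬ Conflict A z (σ.var c.1) (σ.var c.2)) := fun c hc => by
        rw [hv' _ (hl' c hc).1, hv' _ (hl' c hc).2]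
      rw [forall₂_congr e2]
      by_cases hz : z = j
      · subst hz
        have e3 : ∀ y < z, (τ₁.arr a y ≠ 0 → ¬ A y z ↔ τ.arr a y ≠ 0 → ¬ A y z) := fun y hy => by
          rw [e1, if_neg (by lia)]
        simp [e1 z, forall₂_congr e3]
      · simp [hz, e1]
    intro x hx
    have e3 : ∀ y < x, ((listF (conflictF a) l τ₂).arr a y ≠ 0 → ¬ A y x ↔
        τ.arr a y ≠ 0 → ¬ A y x) := fun y hy => by
      rw [E, if_neg (by lia)]
    rw [E x, forall₂_congr e3]
    by_cases hx' : x = j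
    · rw [if_pos hx']
    · rw [if_neg hx']
      exact H x (by lia)

/-- Membership of `x` depends only on the smaller members. This identifies the computed array with
any greedy set for the same pairs. -/
theorem IsGreedy.unique {l : List (ℕ × ℕ)} {I J : ℕ → Prop} (hI : IsGreedy A n l I)
    (hJ : IsGreedy A n l J) : ∀ x < n, I x ↔ J x := by
  intro x
  induction x using Nat.strong_induction_on with
  | _ x ih =>
    intro hx
    rw [hI x hx, hJ x hx]
    have e : ∀ y < x, (I y → ¬ A y x ↔ J y → ¬ A y x) := fun y hy => by rw [ih y hy (by lia)]
    rw [forall₂_congr e]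

end RAM

namespace RAM

variable {A : ℕ → ℕ → Prop} {n k : ℕ} {σ τ : Memory}

/-! ### The complement of two sets, with some vertices added -/

/-- Compute in array `4` the set of the vertices that are in neither of the arrays `2` and `3`, or in
one of the variables in `l`. -/
def complementF (l : List ℕ) (σ : Memory) : Memory :=
  listF (fun c => storeF 4 (.var c) (.lit 1)) l
    (forF 3 (storeF 4 (.var 3) (.sub (.lit 1) (.add (.get 2 (.var 3)) (.get 3 (.var 3))))) σ)

theorem polyComputes_complementF (l : List ℕ) : PolyComputes {3} {4} (complementF l) :=
  (((polyComputes_listF (fun _ => polyComputes_storeF _ _ _) (by simp) l).mono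
    (Set.empty_subset _) subset_rfl).comp (((polyComputes_storeF _ _ _).forF (by simp) (by simp)
    (by simp)).mono (by simp) subset_rfl) (by simp))

theorem listF_storeF_arr (l : List ℕ) : ∀ (σ : Memory) (z : ℕ),
    (listF (fun c => storeF 4 (.var c) (.lit 1)) l σ).arr 4 z ≠ 0 ↔
      σ.arr 4 z ≠ 0 ∨ ∃ c ∈ l, z = σ.var c := by
  induction l with
  | nil => simp [listF]
  | cons c l ih =>
    intro σ z
    have := ih (storeF 4 (.var c) (.lit 1) σ) z
    rw [show listF (fun c => storeF 4 (.var c) (.lit 1)) (c :: l) σ = listF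
      (fun c => storeF 4 (.var c) (.lit 1)) l (storeF 4 (.var c) (.lit 1) σ) from rfl, this]
    have e : (storeF 4 (.var c) (.lit 1) σ).arr 4 z ≠ 0 ↔ σ.arr 4 z ≠ 0 ∨ z = σ.var c := by
      by_cases hz : z = σ.var c <;> simp [storeF, Expr.eval, hz]
    rw [e, or_assoc]
    simp [storeF]

theorem complementF_arr (hσ : σ.var 0 = n) {l : List ℕ} (hl : ∀ c ∈ l, 3 < c) {z : ℕ} (hz : z < n) :
    (complementF l σ).arr 4 z ≠ 0 ↔
      ¬ (σ.arr 2 z ≠ 0 ∨ σ.arr 3 z ≠ 0) ∨ ∃ c ∈ l, z = σ.var c := by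
  have hf := polyComputes_storeF 4 (.var 3)
    (.sub (.lit 1) (.add (.get 2 (.var 3)) (.get 3 (.var 3))))
  have key := hf.forF_induction (i := 3) (by simp)
    (fun j τ => ∀ z < j, τ.arr 4 z ≠ 0 ↔ ¬ (σ.arr 2 z ≠ 0 ∨ σ.arr 3 z ≠ 0)) (σ := σ) (by simp)
    (by
      intro j τ hj hτ hv hr H z hz
      have h2 := hr 2 (by simp)
      have h3 := hr 3 (by simp)
      by_cases hzj : z = j
      · subst hzj
        simp only [storeF, Expr.eval, hτ, h2, h3, Memory.setVar_arr, Memory.setArr_arr, and_self,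
          if_true]
        lia
      · simpa [storeF, Expr.eval, hτ, hzj] using H z (by lia))
  have hv := (hf.forF (i := 3) (by simp) (by simp) (by simp)).var_eq σ
  rw [hσ] at key
  rw [complementF, listF_storeF_arr, key z hz]
  refine or_congr_right (exists_congr fun c => and_congr_right fun hc => ?_)
  rw [hv]
  have := hl c hc
  simp
  lia

/-! ### Counting -/

/-- Compute in variable `6` the number of vertices in array `4`. -/
def countF (σ : Memory) : Memory :=
  forF 3 (whenF (.get 4 (.var 3)) (assignF 6 (.add (.var 6) (.lit 1)))) (assignF 6 (.lit 0) σ)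

theorem polyComputes_countF : PolyComputes {3, 6} ∅ countF := by
  have h := ((polyComputes_assignF 6 (.add (.var 6) (.lit 1))).whenF (.get 4 (.var 3))).forF (i := 3)
    (by simp) (by simp) (by simp)
  exact h.comp ((polyComputes_assignF 6 (.lit 0)).mono (by simp) subset_rfl) (by simp)

theorem countF_var (hσ : σ.var 0 = n) :
    (countF σ).var 6 = Nat.count (fun z => σ.arr 4 z ≠ 0) n := by
  have key := ((polyComputes_assignF 6 (.add (.var 6) (.lit 1))).whenF
    (.get 4 (.var 3))).forF_induction (i := 3) (by simp)
    (fun j τ => τ.var 6 = Nat.count (fun z => σ.arr 4 z ≠ 0) j) (σ := assignF 6 (.lit 0) σ)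
    (by simp [assignF, Expr.eval]) (by
      intro j τ hj hτ hv hr H
      have h4 : τ.arr 4 = σ.arr 4 := hr 4 (by simp)
      rw [Nat.count_succ, ← H]
      by_cases h : σ.arr 4 j = 0 <;> simp [whenF, Expr.eval, hτ, h4, h, assignF])
  rwa [show (assignF 6 (.lit 0) σ).var 0 = n by simp [assignF, hσ]] at key

/-! ### Reachability -/

/-- One step of the search: mark the vertex in variable `4` if it is in array `4` and a neighbour of
the vertex in variable `3` and the latter is marked. -/
def markF : Memory → Memory :=
  whenF (.get 5 (.var 3)) (whenF (adjE (.var 3) (.var 4)) (whenF (.get 4 (.var 4))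
    (storeF 5 (.var 4) (.lit 1))))

/-- Compute in array `5` the vertices that are reachable in array `4` from the vertex in variable
`t`. -/
def reachF (t : ℕ) (σ : Memory) : Memory :=
  forF 5 (forF 3 (forF 4 markF))
    (storeF 5 (.var t) (.lit 1) (forF 3 (storeF 5 (.var 3) (.lit 0)) σ))

/-- Compute in variable `7` whether array `4` is contained in array `5`. -/
def subsetF (σ : Memory) : Memory :=
  forF 3 (whenF (.get 4 (.var 3)) (whenF (.sub (.lit 1) (.get 5 (.var 3))) (assignF 7 (.lit 0))))
    (assignF 7 (.lit 1) σ)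

theorem polyComputes_markF : PolyComputes ∅ {5} markF :=
  (((polyComputes_storeF _ _ _).whenF _).whenF _).whenF _

theorem polyComputes_markF_row : PolyComputes {4} {5} (forF 4 markF) := by
  rw [← insert_empty_eq]
  exact polyComputes_markF.forF (by simp) (by simp) (by simp)

theorem polyComputes_markF_all : PolyComputes {3, 4} {5} (forF 3 (forF 4 markF)) :=
  polyComputes_markF_row.forF (by simp) (by simp) (by simp)

theorem polyComputes_reachF (t : ℕ) : PolyComputes {5, 3, 4} {5} (reachF t) := by
  have h := polyComputes_markF_all.forF (i := 5) (by simp) (by simp) (by simp)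
  have h' := (polyComputes_storeF 5 (.var 3) (.lit 0)).forF (i := 3) (by simp) (by simp) (by simp)
  exact h.comp (((polyComputes_storeF 5 (.var t) (.lit 1)).mono (Set.empty_subset _)
    subset_rfl).comp (h'.mono (by simp) subset_rfl) (by simp)) (by simp)

theorem polyComputes_subsetF : PolyComputes {3, 7} ∅ subsetF := by
  have h := (((polyComputes_assignF 7 (.lit 0)).whenF (.sub (.lit 1) (.get 5 (.var 3)))).whenF
    (.get 4 (.var 3))).forF (i := 3) (by simp) (by simp) (by simp)
  exact h.comp ((polyComputes_assignF 7 (.lit 1)).mono (by simp) subset_rfl) (by simp)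

theorem subsetF_var (hσ : σ.var 0 = n) :
    (subsetF σ).var 7 ≠ 0 ↔ ∀ z < n, σ.arr 4 z ≠ 0 → σ.arr 5 z ≠ 0 := by
  have key := (((polyComputes_assignF 7 (.lit 0)).whenF (.sub (.lit 1) (.get 5 (.var 3)))).whenF
    (.get 4 (.var 3))).forF_induction (i := 3) (by simp)
    (fun j τ => τ.var 7 ≠ 0 ↔ ∀ z < j, σ.arr 4 z ≠ 0 → σ.arr 5 z ≠ 0) (σ := assignF 7 (.lit 1) σ)
    (by simp [assignF, Expr.eval]) (by
      intro j τ hj hτ hv hr H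
      have h4 : τ.arr 4 = σ.arr 4 := hr 4 (by simp)
      have h5 : τ.arr 5 = σ.arr 5 := hr 5 (by simp)
      rw [Nat.forall_lt_succ_right, ← H]
      by_cases h : σ.arr 4 j = 0
      · simp [whenF, Expr.eval, hτ, h4, h]
      · by_cases h' : σ.arr 5 j = 0
        · simp [whenF, Expr.eval, hτ, h4, h5, h, h', assignF]
        · simp [whenF, Expr.eval, hτ, h4, h5, h, h', show 1 - σ.arr 5 j = 0 by lia])
  rwa [show (assignF 7 (.lit 1) σ).var 0 = n by simp [assignF, hσ]] at key

/-- `z` can be reached from `t` in at most `j` steps of `R`. -/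
def ReachIn (R : ℕ → ℕ → Prop) (t : ℕ) : ℕ → ℕ → Prop
  | 0, z => z = t
  | j + 1, z => ReachIn R t j z ∨ ∃ y, ReachIn R t j y ∧ R y z

/-- The edges of the graph on `0, …, n - 1` with adjacency relation `A` that end in `S`. -/
def StepInto (A : ℕ → ℕ → Prop) (n : ℕ) (S : ℕ → Prop) (x y : ℕ) : Prop :=
  x < n ∧ y < n ∧ A x y ∧ S y

theorem Holds.markF_arr (h : Holds A n k σ) (h3 : σ.var 3 < n) (h4 : σ.var 4 < n) (z : ℕ) :
    (markF σ).arr 5 z ≠ 0 ↔ σ.arr 5 z ≠ 0 ∨ z = σ.var 4 ∧ σ.arr 5 (σ.var 3) ≠ 0 ∧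
      A (σ.var 3) (σ.var 4) ∧ σ.arr 4 (σ.var 4) ≠ 0 := by
  have e := h.adjE_eval (x := .var 3) (y := .var 4) h3 h4
  simp only [Expr.eval] at e
  simp only [markF, whenF]
  split_ifs with c1 c2 c3
  · simp only [Expr.eval] at c1
    tauto
  · rw [e] at c2
    tauto
  · simp only [Expr.eval] at c3
    tauto
  · rw [e] at c2
    simp only [Expr.eval] at c1 c3
    by_cases hz : z = σ.var 4
    · simp only [storeF, Expr.eval, Memory.setArr_arr, hz]
      simp
      tauto
    · simp [storeF, Expr.eval, hz]

theorem Holds.markF_row_arr (h : Holds A n k σ) (h3 : σ.var 3 < n) (z : ℕ) :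
    (forF 4 markF σ).arr 5 z ≠ 0 ↔ σ.arr 5 z ≠ 0 ∨ σ.arr 5 (σ.var 3) ≠ 0 ∧
      StepInto A n (fun y => σ.arr 4 y ≠ 0) (σ.var 3) z := by
  have key := polyComputes_markF.forF_induction (i := 4) (by simp)
    (fun j τ => ∀ z, τ.arr 5 z ≠ 0 ↔ σ.arr 5 z ≠ 0 ∨ z < j ∧ σ.arr 5 (σ.var 3) ≠ 0 ∧
      A (σ.var 3) z ∧ σ.arr 4 z ≠ 0) (σ := σ) (by simp) (by
    intro j τ hj hτ hv hr H z
    rw [h.var_zero] at hj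
    have hx : τ.var 3 = σ.var 3 := hv 3 (by simp) (by simp)
    have h' : Holds A n k τ := h.congr (hv 0 (by simp) (by simp)) (hv 1 (by simp) (by simp))
      (hr 0 (by simp)) (hr 1 (by simp))
    rw [Memory.setVar_arr, h'.markF_arr (by rwa [hx]) (by rwa [hτ]), H, H, hx, hτ, hr 4 (by simp)]
    have : z < j + 1 ↔ z < j ∨ z = j := by lia
    rw [this]
    constructor
    · rintro (h | ⟨rfl, h1 | h1, h2, h3⟩) <;> tauto
    · rintro (h | ⟨h1 | rfl, h⟩) <;> tauto) z
  rw [key, h.var_zero, StepInto]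
  tauto

/-- Marks are written in place, so one sweep may advance by more than one step, depending on the
vertex order. It is therefore described from two sides: at least one step is made, and no predicate
closed under steps is left. -/
theorem Holds.markF_all_arr (h : Holds A n k σ) :
    (∀ z, σ.arr 5 z ≠ 0 ∨ (∃ y, σ.arr 5 y ≠ 0 ∧ StepInto A n (fun y => σ.arr 4 y ≠ 0) y z) →
      (forF 3 (forF 4 markF) σ).arr 5 z ≠ 0) ∧
    ∀ P : ℕ → Prop, (∀ z, σ.arr 5 z ≠ 0 → P z) →
      (∀ y z, P y → StepInto A n (fun y => σ.arr 4 y ≠ 0) y z → P z) →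
      ∀ z, (forF 3 (forF 4 markF) σ).arr 5 z ≠ 0 → P z := by
  have key := polyComputes_markF_row.forF_induction (i := 3) (by simp)
    (fun j τ => (∀ z, σ.arr 5 z ≠ 0 ∨
        (∃ y < j, σ.arr 5 y ≠ 0 ∧ StepInto A n (fun y => σ.arr 4 y ≠ 0) y z) → τ.arr 5 z ≠ 0) ∧
      ∀ P : ℕ → Prop, (∀ z, σ.arr 5 z ≠ 0 → P z) →
        (∀ y z, P y → StepInto A n (fun y => σ.arr 4 y ≠ 0) y z → P z) →
        ∀ z, τ.arr 5 z ≠ 0 → P z) (σ := σ) ⟨by simp, fun P h _ => h⟩ (by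
    intro j τ hj hτ hv hr H
    rw [h.var_zero] at hj
    have h' : Holds A n k τ := h.congr (hv 0 (by simp) (by simp)) (hv 1 (by simp) (by simp))
      (hr 0 (by simp)) (hr 1 (by simp))
    have E := h'.markF_row_arr (by rwa [hτ])
    rw [hτ, hr 4 (by simp)] at E
    simp only [Memory.setVar_arr]
    refine ⟨fun z hz => ?_, fun P h1 h2 z hz => ?_⟩
    · rw [E]
      rcases hz with hz | ⟨y, hy, hy', hyz⟩
      · exact Or.inl (H.1 z (Or.inl hz))
      · rcases Nat.lt_succ_iff_lt_or_eq.1 hy with hy | rfl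
        · exact Or.inl (H.1 z (Or.inr ⟨y, hy, hy', hyz⟩))
        · exact Or.inr ⟨H.1 y (Or.inl hy'), hyz⟩
    · rcases (E z).1 hz with hz | ⟨hz, hz'⟩
      · exact H.2 P h1 h2 z hz
      · exact h2 j z (H.2 P h1 h2 j hz) hz')
  rw [h.var_zero] at key
  refine ⟨fun z hz => key.1 z (hz.imp_right ?_), key.2⟩
  rintro ⟨y, hy⟩
  exact ⟨y, hy.2.1, hy⟩

/-- Each of the `n` sweeps makes at least one step, and everything marked is reachable in some
number of steps. The two halves leave a gap that closes because paths have fewer than `n` edges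
(`reachIn_of_reachable`). -/
theorem Holds.reachF_arr (h : Holds A n k σ) {t : ℕ} (ht : 5 < t) :
    (∀ z, ReachIn (StepInto A n fun y => σ.arr 4 y ≠ 0) (σ.var t) n z →
      (reachF t σ).arr 5 z ≠ 0) ∧ ∀ z < n, (reachF t σ).arr 5 z ≠ 0 →
        ∃ j, ReachIn (StepInto A n fun y => σ.arr 4 y ≠ 0) (σ.var t) j z := by
  have hf := polyComputes_storeF 5 (.var 3) (.lit 0)
  have hf' := hf.forF (i := 3) (by simp) (by simp) (by simp)
  set σ₁ := forF 3 (storeF 5 (.var 3) (.lit 0)) σ with hσ₁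
  set σ₂ := storeF 5 (.var t) (.lit 1) σ₁ with hσ₂
  have hv₁ : ∀ x, x ≠ 3 → σ₁.var x = σ.var x := fun x hx => hf'.var_eq σ x (by simpa using hx)
  have hr₂ : ∀ a, a ≠ 5 → σ₂.arr a = σ.arr a := fun a ha =>
    ((polyComputes_storeF 5 (.var t) (.lit 1)).arr_eq _ a ha).trans (hf'.arr_eq σ a ha)
  have h₂ : Holds A n k σ₂ := h.congr (hv₁ 0 (by simp)) (hv₁ 1 (by simp)) (hr₂ 0 (by simp))
    (hr₂ 1 (by simp))
  have k₁ : ∀ z < n, σ₁.arr 5 z = 0 := by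
    have := hf.forF_induction (i := 3) (by simp) (fun j τ => ∀ z < j, τ.arr 5 z = 0) (σ := σ)
      (by simp) (by
        intro j τ hj hτ hv hr H z hz
        by_cases hzj : z = j
        · simp [storeF, Expr.eval, hτ, hzj]
        · simpa [storeF, Expr.eval, hτ, hzj] using H z (by lia))
    rwa [h.var_zero] at this
  have k₂ : ∀ z, σ₂.arr 5 z = if z = σ.var t then 1 else σ₁.arr 5 z := fun z => by
    simp [hσ₂, storeF, Expr.eval, hv₁ t (by lia)]
  have key := polyComputes_markF_all.forF_induction (i := 5) (by simp)
    (fun j τ => (∀ z, ReachIn (StepInto A n fun y => σ.arr 4 y ≠ 0) (σ.var t) j z →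
        τ.arr 5 z ≠ 0) ∧ ∀ z < n, τ.arr 5 z ≠ 0 →
        ∃ j, ReachIn (StepInto A n fun y => σ.arr 4 y ≠ 0) (σ.var t) j z) (σ := σ₂)
    ⟨fun z hz => by simp [k₂, show z = σ.var t from hz], fun z hz hz' => ⟨0, by
      by_contra hne
      exact hz' (by simpa [k₂, show z ≠ σ.var t from hne] using k₁ z hz)⟩⟩ (by
    intro j τ hj hτ hv hr H
    have h' : Holds A n k τ := h₂.congr (hv 0 (by simp) (by simp)) (hv 1 (by simp) (by simp))
      (hr 0 (by simp)) (hr 1 (by simp))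
    have E := h'.markF_all_arr
    rw [hr 4 (by simp), hr₂ 4 (by simp)] at E
    simp only [Memory.setVar_arr]
    refine ⟨fun z hz => E.1 z ?_, fun z hzn hz => ?_⟩
    · rcases hz with hz | ⟨y, hy, hyz⟩
      · exact Or.inl (H.1 z hz)
      · exact Or.inr ⟨y, H.1 y hy, hyz⟩
    · refine E.2 (fun z => z < n →
        ∃ j, ReachIn (StepInto A n fun y => σ.arr 4 y ≠ 0) (σ.var t) j z)
        (fun z hz hz' => H.2 z hz' hz) (fun y z hy hyz _ => ?_) z hz hzn
      obtain ⟨i, hi⟩ := hy hyz.1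
      exact ⟨i + 1, Or.inr ⟨y, hi, hyz⟩⟩)
  rwa [h₂.var_zero] at key

end RAM

namespace RAM

variable {A : ℕ → ℕ → Prop} {n k : ℕ} {σ τ : Memory}

/-! ### Exhaustive search over tuples of vertices -/

/-- Run `f` for all values in `0, …, n - 1` of the variables `20, …, 20 + m - 1`. -/
def guessF (f : Memory → Memory) : ℕ → Memory → Memory
  | 0 => f
  | m + 1 => forF (20 + m) (guessF f m)

theorem polyComputes_guessF {f : Memory → Memory}
    (hf : PolyComputes {x | 2 ≤ x ∧ x < 20} {a | 2 ≤ a} f) (m : ℕ) :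
    PolyComputes {x | 2 ≤ x ∧ x < 20 + m} {a | 2 ≤ a} (guessF f m) := by
  induction m with
  | zero => exact hf
  | succ m ih =>
    refine (ih.forF (i := 20 + m) (by simp) (by simp) (by simp)).mono ?_ subset_rfl
    intro x hx
    simp only [Set.mem_insert_iff, Set.mem_ofPred_eq] at hx ⊢
    lia

/-- The answer flag, variable `2`, stays nonzero once set, so the nested loops compute a disjunction
over tuples. Two predicates are needed because a check is only assumed sound for `P` and complete
for `Q`; for connectivity these differ in the number of search steps. -/
theorem guessF_var {f : Memory → Memory}
    (hf : PolyComputes {x | 2 ≤ x ∧ x < 20} {a | 2 ≤ a} f) {M : ℕ} {P Q : (ℕ → ℕ) → Prop}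
    (h : ∀ σ, Holds A n k σ → (∀ j < M, σ.var (20 + j) < n) →
      ((f σ).var 2 ≠ 0 → σ.var 2 ≠ 0 ∨ P fun j => σ.var (20 + j)) ∧
      (σ.var 2 ≠ 0 ∨ Q (fun j => σ.var (20 + j)) → (f σ).var 2 ≠ 0)) :
    ∀ m ≤ M, ∀ σ, Holds A n k σ → (∀ j, m ≤ j → j < M → σ.var (20 + j) < n) →
      ((guessF f m σ).var 2 ≠ 0 → σ.var 2 ≠ 0 ∨ ∃ ξ : ℕ → ℕ, (∀ j < M, ξ j < n) ∧ P ξ) ∧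
      ((σ.var 2 ≠ 0 ∨ ∃ ξ : ℕ → ℕ, (∀ j < M, ξ j < n) ∧ (∀ j, m ≤ j → ξ j = σ.var (20 + j)) ∧ Q ξ) →
        (guessF f m σ).var 2 ≠ 0) := by
  intro m
  induction m with
  | zero =>
    intro _ σ hσ hj
    have := h σ hσ fun j => hj j (Nat.zero_le j)
    refine ⟨fun hh => (this.1 hh).imp_right fun hP => ⟨_, fun j => hj j (Nat.zero_le j), hP⟩,
      fun hh => this.2 (hh.imp_right ?_)⟩
    rintro ⟨ξ, -, hξ, hQ⟩
    rwa [← show ξ = fun j => σ.var (20 + j) from funext fun j => hξ j (Nat.zero_le j)]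
  | succ m ih =>
    intro hm σ hσ hj
    have key := (polyComputes_guessF hf m).forF_induction (i := 20 + m) (by simp)
      (fun i τ => (τ.var 2 ≠ 0 → σ.var 2 ≠ 0 ∨ ∃ ξ : ℕ → ℕ, (∀ j < M, ξ j < n) ∧ P ξ) ∧
      ((σ.var 2 ≠ 0 ∨ ∃ ξ : ℕ → ℕ, (∀ j < M, ξ j < n) ∧ ξ m < i ∧
        (∀ j, m + 1 ≤ j → ξ j = σ.var (20 + j)) ∧ Q ξ) → τ.var 2 ≠ 0)) (σ := σ)
      (by simp [show 2 ≠ 20 + m by lia]; tauto) (by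
        intro i τ hi hτ hv hr H
        rw [hσ.var_zero] at hi
        have hv' : ∀ j, m + 1 ≤ j → τ.var (20 + j) = σ.var (20 + j) := fun j hjm =>
          hv _ (by simp; lia) (by lia)
        have hτ' : Holds A n k τ := hσ.congr (hv 0 (by simp) (by lia)) (hv 1 (by simp) (by lia))
          (hr 0 (by simp)) (hr 1 (by simp))
        have hb : ∀ j, m ≤ j → j < M → τ.var (20 + j) < n := by
          intro j hj1 hj2
          rcases hj1.eq_or_lt with rfl | hj1
          · rwa [hτ]
          · rw [hv' j hj1]
            exact hj j hj1 hj2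
        have E := ih (by lia) τ hτ' hb
        have e2 : ((guessF f m τ).setVar (20 + m) (i + 1)).var 2 = (guessF f m τ).var 2 := by
          simp [show 2 ≠ 20 + m by lia]
        rw [e2]
        refine ⟨fun hh => (E.1 hh).elim H.1 Or.inr, fun hh => E.2 ?_⟩
        rcases hh with hh | ⟨ξ, h1, h2, h3, h4⟩
        · exact Or.inl (H.2 (Or.inl hh))
        · rcases Nat.lt_succ_iff_lt_or_eq.1 h2 with h2 | h2
          · exact Or.inl (H.2 (Or.inr ⟨ξ, h1, h2, h3, h4⟩))
          · refine Or.inr ⟨ξ, h1, fun j hjm => ?_, h4⟩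
            rcases hjm.eq_or_lt with rfl | hjm
            · rw [h2, hτ]
            · rw [h3 j hjm, hv' j hjm])
    rw [hσ.var_zero] at key
    refine ⟨key.1, fun hh => key.2 (hh.imp_right ?_)⟩
    rintro ⟨ξ, h1, h2, h3⟩
    exact ⟨ξ, h1, h1 m (by lia), h2, h3⟩

/-! ### Reading the input -/

/-- The adjacency relation of a graph on `0, …, n - 1`. -/
def natAdj (G : SimpleGraph (Fin n)) (i j : ℕ) : Prop :=
  ∃ (hi : i < n) (hj : j < n), G.Adj ⟨i, hi⟩ ⟨j, hj⟩

/-- Compute in array `1` the multiples of `n`. -/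
def rowsF (σ : Memory) : Memory :=
  forF 3 (fun σ => assignF 6 (.add (.var 6) (.var 0)) (storeF 1 (.var 3) (.var 6) σ))
    (assignF 6 (.lit 0) σ)

theorem polyComputes_rowsF_body : PolyComputes {6} {1}
    (fun σ => assignF 6 (.add (.var 6) (.var 0)) (storeF 1 (.var 3) (.var 6) σ)) :=
  ((polyComputes_assignF 6 _).mono subset_rfl (Set.empty_subset _)).comp
    ((polyComputes_storeF 1 _ _).mono (Set.empty_subset _) subset_rfl) (by simp)

theorem polyComputes_rowsF : PolyComputes {3, 6} {1} rowsF := by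
  have h := polyComputes_rowsF_body.forF (i := 3) (by simp) (by simp) (by simp)
  exact h.comp ((polyComputes_assignF 6 (.lit 0)).mono (by simp) (Set.empty_subset _)) (by simp)

/-- The row offsets `i * n` are obtained by repeated addition, there being no multiplication. A
position `i * n + j` with `j < n` determines `i` and `j` by division. -/
theorem holds_rowsF (G : SimpleGraph (Fin n)) (k : ℕ) :
    Holds (natAdj G) n k (rowsF (inputMemory G k)) := by
  have hv := polyComputes_rowsF.var_eq (inputMemory G k)
  have hr := polyComputes_rowsF.arr_eq (inputMemory G k)
  have key := polyComputes_rowsF_body.forF_induction (i := 3) (by simp)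
    (fun j τ => τ.var 6 = j * n ∧ ∀ z < j, τ.arr 1 z = z * n)
    (σ := assignF 6 (.lit 0) (inputMemory G k)) (by simp [assignF, Expr.eval]) (by
      intro j τ hj hτ hv hr H
      have h0 : τ.var 0 = n := by
        rw [hv 0 (by simp) (by simp)]
        simp [assignF, inputMemory]
      refine ⟨by simp [assignF, Expr.eval, storeF, h0, H.1, add_mul], fun z hz => ?_⟩
      by_cases hzj : z = j
      · simp [assignF, Expr.eval, storeF, hτ, hzj, H.1]
      · simpa [assignF, Expr.eval, storeF, hτ, hzj] using H.2 z (by lia))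
  rw [show (assignF 6 (.lit 0) (inputMemory G k)).var 0 = n by simp [assignF, inputMemory]] at key
  refine ⟨by rw [hv 0 (by simp)]; rfl, by rw [hv 1 (by simp)]; rfl, fun i hi j hj => ?_⟩
  rw [show (rowsF (inputMemory G k)).arr 1 i = i * n from key.2 i hi, hr 0 (by simp)]
  simp only [inputMemory, true_and, ne_eq, ite_eq_right_iff, one_ne_zero, imp_false, not_not]
  constructor
  · rintro ⟨i', j', h, hA⟩
    have hn : 0 < n := by lia
    have e1 : i = i' := by
      have := congrArg (· / n) h
      simpa [add_comm (_ * n), Nat.add_mul_div_right _ _ hn, Nat.div_eq_of_lt hj,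
        Nat.div_eq_of_lt j'.2] using this
    have e2 : j = j' := by
      rw [e1] at h
      lia
    subst e1 e2
    exact ⟨i'.2, j'.2, hA⟩
  · rintro ⟨hi, hj, hA⟩
    exact ⟨⟨i, hi⟩, ⟨j, hj⟩, rfl, hA⟩

/-- The expression `e` presets the answer flag; it can settle inputs such as `n = 0`, where loops
over the vertices have no rounds. The witness for `Q` vanishes from `M` on because the variables
beyond the guessed ones are still zero. -/
theorem polyTimeSolvableOn_of_guessF {C : ∀ n : ℕ, SimpleGraph (Fin n) → Prop}
    {D : ∀ n : ℕ, SimpleGraph (Fin n) → ℕ → Prop} {f : Memory → Memory}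
    (hf : PolyComputes {x | 2 ≤ x ∧ x < 20} {a | 2 ≤ a} f) (e : Expr) (M : ℕ)
    (P Q : ∀ n : ℕ, SimpleGraph (Fin n) → ℕ → (ℕ → ℕ) → Prop)
    (h : ∀ n G k σ, C n G → Holds (natAdj G) n k σ → (∀ j < M, σ.var (20 + j) < n) →
      ((f σ).var 2 ≠ 0 → σ.var 2 ≠ 0 ∨ P n G k fun j => σ.var (20 + j)) ∧
      (σ.var 2 ≠ 0 ∨ Q n G k (fun j => σ.var (20 + j)) → (f σ).var 2 ≠ 0))
    (he : ∀ n G k σ, C n G → Holds (natAdj G) n k σ → e.eval σ ≠ 0 → D n G k)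
    (hP : ∀ n G k ξ, C n G → (∀ j < M, ξ j < n) → P n G k ξ → D n G k)
    (hQ : ∀ n G k σ, C n G → D n G k → Holds (natAdj G) n k σ → e.eval σ ≠ 0 ∨
      ∃ ξ : ℕ → ℕ, (∀ j < M, ξ j < n) ∧ (∀ j, M ≤ j → ξ j = 0) ∧ Q n G k ξ) :
    PolyTimeSolvableOn C D := by
  have hg := (polyComputes_guessF hf M).mono (X' := {x | 2 ≤ x}) (Y' := {a | 1 ≤ a})
    (fun x hx => hx.1) (fun x (hx : 2 ≤ x) => by simp; lia)
  have hi : PolyComputes {x | 2 ≤ x} {a | 1 ≤ a} (fun σ => assignF 2 e (rowsF σ)) :=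
    ((polyComputes_assignF 2 e).mono (by simp) (by simp)).comp
      (polyComputes_rowsF.mono (by simp [Set.insert_subset_iff]) (by simp)) (by simp)
  obtain ⟨p, b, hp⟩ := (hg.comp hi (by simp)).runs
  refine ⟨.seq p (.assign 0 (.var 2)), b + Polynomial.C 2, fun n G k hC => ?_⟩
  obtain ⟨t, ht, htb⟩ := hp (inputMemory G k)
  have h2 : Runs (.assign 0 (.var 2)) (guessF f M (assignF 2 e (rowsF (inputMemory G k)))) 2 _ :=
    .assign 0 (.var 2) _
  refine ⟨_, _, .seq ht h2, ?_, ?_⟩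
  · rw [Polynomial.eval_add, Polynomial.eval_C]
    exact Nat.add_le_add_right htb 2
  · have hH := holds_rowsF G k
    set σ₁ := rowsF (inputMemory G k)
    have hv : ∀ j, (assignF 2 e σ₁).var (20 + j) = 0 := fun j => by
      simp only [assignF, Memory.setVar_var, show 20 + j ≠ 2 by lia, if_false]
      rw [polyComputes_rowsF.var_eq _ _ (by simp; lia)]
      simp [inputMemory]
      lia
    have hH' : Holds (natAdj G) n k (assignF 2 e σ₁) := hH.congr (by simp [assignF])
      (by simp [assignF]) rfl rfl
    have key := guessF_var hf (M := M) (fun σ => h n G k σ hC) M le_rfl (assignF 2 e σ₁) hH'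
      (fun j h1 h2 => by lia)
    have e2 : (assignF 2 e σ₁).var 2 = e.eval σ₁ := by simp [assignF]
    simp only [e2, hv] at key
    simp only [Memory.setVar_var, if_true, Expr.eval]
    constructor
    · intro hne
      rcases key.1 hne with h | ⟨ξ, h1, h2⟩
      · exact he n G k _ hC hH h
      · exact hP n G k ξ hC h1 h2
    · intro hD
      exact key.2 (hQ n G k _ hC hD hH)

/-! ### The two checks -/

/-- The `s` consecutive pairs of values of `ξ` that start at `o`. -/
def pairsOf (ξ : ℕ → ℕ) (o s : ℕ) : List (ℕ × ℕ) :=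
  (List.range s).map fun t => (ξ (o + 2 * t), ξ (o + 2 * t + 1))

/-- Compute in array `4` the set of vertices given by the values of the variables `20, …`, and in
variable `6` the number of its elements. -/
def selectF (s c : ℕ) (σ : Memory) : Memory :=
  countF (complementF ((List.range c).map fun j => 20 + (4 * s + j))
    (greedyF 3 (pairsOf (20 + ·) (2 * s) s) (greedyF 2 (pairsOf (20 + ·) 0 s) σ)))

/-- `S` consists of the vertices outside of the two greedy independent sets given by the pairs in `ξ`
and of the remaining vertices in `ξ`. -/
def IsSelection (A : ℕ → ℕ → Prop) (n s c : ℕ) (ξ : ℕ → ℕ) (S : ℕ → Prop) : Prop :=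
  ∃ I J, IsGreedy A n (pairsOf ξ 0 s) I ∧ IsGreedy A n (pairsOf ξ (2 * s) s) J ∧
    ∀ z, S z ↔ z < n ∧ (¬ (I z ∨ J z) ∨ ∃ j < c, z = ξ (4 * s + j))

theorem IsSelection.unique {s c : ℕ} {ξ : ℕ → ℕ} {S S' : ℕ → Prop} (h : IsSelection A n s c ξ S)
    (h' : IsSelection A n s c ξ S') : S = S' := by
  obtain ⟨I, J, hI, hJ, hS⟩ := h
  obtain ⟨I', J', hI', hJ', hS'⟩ := h'
  ext z
  rw [hS, hS']
  refine and_congr_right fun hz => ?_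
  rw [hI.unique hI' z hz, hJ.unique hJ' z hz]

theorem polyComputes_selectF (s c : ℕ) : PolyComputes {3, 4, 6} {2, 3, 4} (selectF s c) := by
  have h1 := (polyComputes_greedyF 2 (pairsOf (20 + ·) 0 s)).mono (X' := {3, 4, 6})
    (Y' := {2, 3, 4}) (by simp [Set.insert_subset_iff]) (by simp)
  have h2 := (polyComputes_greedyF 3 (pairsOf (20 + ·) (2 * s) s)).mono (X' := {3, 4, 6})
    (Y' := {2, 3, 4}) (by simp [Set.insert_subset_iff]) (by simp)
  have h3 := (polyComputes_complementF ((List.range c).map fun j => 20 + (4 * s + j))).mono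
    (X' := {3, 4, 6}) (Y' := {2, 3, 4}) (by simp) (by simp)
  have h4 := polyComputes_countF.mono (X' := {3, 4, 6}) (Y' := {2, 3, 4})
    (by simp [Set.insert_subset_iff]) (by simp)
  exact h4.comp (h3.comp (h2.comp h1 (by simp)) (by simp)) (by simp)

theorem Holds.selectF (h : Holds A n k σ) {s c : ℕ} (hσ : ∀ j < 4 * s + c, σ.var (20 + j) < n) :
    Holds A n k (selectF s c σ) ∧ ∃ S, IsSelection A n s c (fun j => σ.var (20 + j)) S ∧
      (∀ z < n, S z ↔ (RAM.selectF s c σ).arr 4 z ≠ 0) ∧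
      (RAM.selectF s c σ).var 6 = {z | S z}.ncard := by
  have hf := polyComputes_selectF s c
  refine ⟨h.congr (hf.var_eq _ 0 (by simp)) (hf.var_eq _ 1 (by simp)) (hf.arr_eq _ 0 (by simp))
    (hf.arr_eq _ 1 (by simp)), ?_⟩
  have f₁ := polyComputes_greedyF 2 (pairsOf (20 + ·) 0 s)
  have f₂ := polyComputes_greedyF 3 (pairsOf (20 + ·) (2 * s) s)
  have f₃ := polyComputes_complementF ((List.range c).map fun j => 20 + (4 * s + j))
  rw [RAM.selectF]
  set σ₁ := greedyF 2 (pairsOf (20 + ·) 0 s) σ with hσ₁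
  set σ₂ := greedyF 3 (pairsOf (20 + ·) (2 * s) s) σ₁ with hσ₂
  set σ₃ := complementF ((List.range c).map fun j => 20 + (4 * s + j)) σ₂ with hσ₃
  have hv₁ : ∀ x, x ≠ 3 → x ≠ 4 → σ₁.var x = σ.var x := fun x h1 h2 =>
    f₁.var_eq σ x (by simp [h1, h2])
  have hv₂ : ∀ x, x ≠ 3 → x ≠ 4 → σ₂.var x = σ.var x := fun x h1 h2 =>
    (f₂.var_eq σ₁ x (by simp [h1, h2])).trans (hv₁ x h1 h2)
  have H₁ : Holds A n k σ₁ := h.congr (hv₁ 0 (by simp) (by simp)) (hv₁ 1 (by simp) (by simp))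
    (f₁.arr_eq σ 0 (by simp)) (f₁.arr_eq σ 1 (by simp))
  have hb : ∀ o, o + 2 * s ≤ 4 * s → ∀ d ∈ pairsOf (20 + ·) o s, (σ.var d.1 < n ∧ σ.var d.2 < n) ∧
      4 < d.1 ∧ 4 < d.2 := by
    intro o ho d hd
    obtain ⟨t, ht, rfl⟩ := List.mem_map.1 hd
    rw [List.mem_range] at ht
    exact ⟨⟨hσ _ (by lia), hσ _ (by lia)⟩, by simp; lia, by simp; lia⟩
  have g₁ := h.isGreedy_greedyF (a := 2) (by simp) (by simp) (pairsOf (20 + ·) 0 s)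
    (fun d hd => (hb 0 (by lia) d hd).1) (fun d hd => (hb 0 (by lia) d hd).2)
  have g₂ := H₁.isGreedy_greedyF (a := 3) (by simp) (by simp) (pairsOf (20 + ·) (2 * s) s)
    (fun d hd => by
      have := hb (2 * s) (by lia) d hd
      rw [hv₁ d.1 (by lia) (by lia), hv₁ d.2 (by lia) (by lia)]
      exact this.1) (fun d hd => (hb (2 * s) (by lia) d hd).2)
  rw [← hσ₁, pairsOf, List.map_map] at g₁
  rw [← hσ₂, pairsOf, List.map_map] at g₂
  have a₂ : σ₂.arr 2 = σ₁.arr 2 := f₂.arr_eq σ₁ 2 (by simp)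
  have g₃ := fun z (hz : z < n) => complementF_arr (σ := σ₂) (n := n)
    ((hv₂ 0 (by simp) (by simp)).trans h.var_zero)
    (l := (List.range c).map fun j => 20 + (4 * s + j)) (by
      intro d hd
      obtain ⟨t, ht, rfl⟩ := List.mem_map.1 hd
      lia) hz
  have a₃ : (countF σ₃).arr 4 = σ₃.arr 4 := polyComputes_countF.arr_eq σ₃ 4 (by simp)
  refine ⟨fun z => z < n ∧ σ₃.arr 4 z ≠ 0, ⟨fun z => σ₁.arr 2 z ≠ 0, fun z => σ₂.arr 3 z ≠ 0,
    g₁, ?_, fun z => and_congr_right fun hz => ?_⟩, fun z hz => ?_, ?_⟩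
  · rw [pairsOf]
    convert g₂ using 1
    refine List.map_congr_left fun t _ => ?_
    simp only [Function.comp]
    rw [hv₁ _ (by lia) (by lia), hv₁ _ (by lia) (by lia)]
  · rw [hσ₃, g₃ z hz, a₂]
    refine or_congr_right ?_
    simp only [List.mem_map, List.mem_range]
    constructor
    · rintro ⟨d, ⟨j, hj, rfl⟩, hd⟩
      rw [hv₂ _ (by lia) (by lia)] at hd
      exact ⟨j, hj, hd⟩
    · rintro ⟨j, hj, hd⟩
      refine ⟨_, ⟨j, hj, rfl⟩, ?_⟩
      rwa [hv₂ _ (by lia) (by lia)]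
  · rw [a₃]
    exact and_iff_right hz
  · rw [countF_var ((f₃.var_eq σ₂ 0 (by simp)).trans ((hv₂ 0 (by simp) (by simp)).trans h.var_zero)),
      Nat.count_eq_card_filter_range, ← Set.ncard_coe_finset]
    congr 1
    ext z
    rw [Finset.mem_coe, Finset.mem_filter, Finset.mem_range]
    rfl

/-- The check for Odd Cycle Transversal. -/
def checkF (s : ℕ) (σ : Memory) : Memory :=
  whenF (.sub (.lit 1) (.sub (.var 6) (.var 1))) (assignF 2 (.lit 1)) (selectF s 0 σ)

/-- The check for Connected Odd Cycle Transversal. -/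
def connectedCheckF (s c : ℕ) (σ : Memory) : Memory :=
  whenF (.var 7) (whenF (.sub (.lit 1) (.sub (.var 6) (.var 1))) (assignF 2 (.lit 1)))
    (subsetF (reachF (20 + 4 * s) (selectF s c σ)))

theorem polyComputes_checkF (s : ℕ) :
    PolyComputes {x | 2 ≤ x ∧ x < 20} {a | 2 ≤ a} (checkF s) := by
  have h1 := ((polyComputes_assignF 2 (.lit 1)).whenF (.sub (.lit 1) (.sub (.var 6) (.var 1)))).mono
    (X' := {x | 2 ≤ x ∧ x < 20}) (Y' := {a | 2 ≤ a}) (by simp) (by simp)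
  have h2 := (polyComputes_selectF s 0).mono
    (X' := {x | 2 ≤ x ∧ x < 20}) (Y' := {a | 2 ≤ a}) (by simp [Set.insert_subset_iff])
    (by simp [Set.insert_subset_iff])
  exact h1.comp h2 (by simp)

theorem polyComputes_connectedCheckF (s c : ℕ) :
    PolyComputes {x | 2 ≤ x ∧ x < 20} {a | 2 ≤ a} (connectedCheckF s c) := by
  have h1 := (((polyComputes_assignF 2 (.lit 1)).whenF
    (.sub (.lit 1) (.sub (.var 6) (.var 1)))).whenF (.var 7)).mono
    (X' := {x | 2 ≤ x ∧ x < 20}) (Y' := {a | 2 ≤ a}) (by simp) (by simp)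
  have h2 := (polyComputes_selectF s c).mono
    (X' := {x | 2 ≤ x ∧ x < 20}) (Y' := {a | 2 ≤ a}) (by simp [Set.insert_subset_iff])
    (by simp [Set.insert_subset_iff])
  have h3 := (polyComputes_reachF (20 + 4 * s)).mono
    (X' := {x | 2 ≤ x ∧ x < 20}) (Y' := {a | 2 ≤ a}) (by simp [Set.insert_subset_iff]) (by simp)
  have h4 := polyComputes_subsetF.mono
    (X' := {x | 2 ≤ x ∧ x < 20}) (Y' := {a | 2 ≤ a}) (by simp [Set.insert_subset_iff]) (by simp)
  exact h1.comp (h4.comp (h3.comp h2 (by simp)) (by simp)) (by simp)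

theorem Holds.checkF_var (h : Holds A n k σ) {s : ℕ} (hσ : ∀ j < 4 * s, σ.var (20 + j) < n) :
    (checkF s σ).var 2 ≠ 0 ↔ σ.var 2 ≠ 0 ∨
      ∃ S, IsSelection A n s 0 (fun j => σ.var (20 + j)) S ∧ {z | S z}.ncard ≤ k := by
  obtain ⟨h', S, hS, -, hc⟩ := h.selectF (c := 0) hσ
  have e2 : (RAM.selectF s 0 σ).var 2 = σ.var 2 := (polyComputes_selectF s 0).var_eq σ 2 (by simp)
  have e : (∃ S, IsSelection A n s 0 (fun j => σ.var (20 + j)) S ∧ {z | S z}.ncard ≤ k) ↔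
      {z | S z}.ncard ≤ k :=
    ⟨fun ⟨S', hS', hk⟩ => by rwa [hS.unique hS'], fun hk => ⟨S, hS, hk⟩⟩
  rw [e]
  by_cases hk : {z | S z}.ncard ≤ k
  · have : ¬ 1 - ({z | S z}.ncard - k) = 0 := by lia
    simp [checkF, whenF, Expr.eval, hc, h'.var_one, hk, assignF]
  · have : 1 - ({z | S z}.ncard - k) = 0 := by lia
    simp [checkF, whenF, Expr.eval, hc, h'.var_one, this, hk, e2]

theorem Holds.connectedCheckF_var (h : Holds A n k σ) {s c : ℕ}
    (hσ : ∀ j < 4 * s + c, σ.var (20 + j) < n) :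
    ((connectedCheckF s c σ).var 2 ≠ 0 → σ.var 2 ≠ 0 ∨
      ∃ S, IsSelection A n s c (fun j => σ.var (20 + j)) S ∧ {z | S z}.ncard ≤ k ∧
        ∀ z < n, S z → ∃ j, ReachIn (StepInto A n S) (σ.var (20 + 4 * s)) j z) ∧
    ((σ.var 2 ≠ 0 ∨
      ∃ S, IsSelection A n s c (fun j => σ.var (20 + j)) S ∧ {z | S z}.ncard ≤ k ∧
        ∀ z < n, S z → ReachIn (StepInto A n S) (σ.var (20 + 4 * s)) n z) →
      (connectedCheckF s c σ).var 2 ≠ 0) := by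
  obtain ⟨h', S, hS, hz, hc⟩ := h.selectF hσ
  have f₁ := polyComputes_selectF s c
  have f₂ := polyComputes_reachF (20 + 4 * s)
  have f₃ := polyComputes_subsetF
  have E := h'.reachF_arr (t := 20 + 4 * s) (by lia)
  rw [f₁.var_eq σ (20 + 4 * s) (by simp; lia), show (StepInto A n fun y =>
    (RAM.selectF s c σ).arr 4 y ≠ 0) = StepInto A n S by
      ext x y
      exact and_congr_right fun _ => and_congr_right fun hy => and_congr_right fun _ =>
        (hz y hy).symm] at E
  rw [connectedCheckF]
  have e2 : (RAM.selectF s c σ).var 2 = σ.var 2 := f₁.var_eq σ 2 (by simp)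
  set σ₁ := RAM.selectF s c σ
  set σ₂ := reachF (20 + 4 * s) σ₁
  have k2 : (subsetF σ₂).var 2 = σ.var 2 :=
    (f₃.var_eq _ 2 (by simp)).trans ((f₂.var_eq _ 2 (by simp)).trans e2)
  have k6 : (subsetF σ₂).var 6 = {z | S z}.ncard :=
    (f₃.var_eq _ 6 (by simp)).trans ((f₂.var_eq _ 6 (by simp)).trans hc)
  have k1 : (subsetF σ₂).var 1 = k :=
    (f₃.var_eq _ 1 (by simp)).trans ((f₂.var_eq _ 1 (by simp)).trans h'.var_one)
  have k7 : (subsetF σ₂).var 7 ≠ 0 ↔ ∀ z < n, S z → σ₂.arr 5 z ≠ 0 := by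
    rw [subsetF_var ((f₂.var_eq _ 0 (by simp)).trans h'.var_zero), f₂.arr_eq σ₁ 4 (by simp)]
    exact forall₂_congr fun z hzn => by rw [hz z hzn]
  set σ₃ := subsetF σ₂
  have key : (whenF (.var 7) (whenF (.sub (.lit 1) (.sub (.var 6) (.var 1))) (assignF 2 (.lit 1)))
      σ₃).var 2 ≠ 0 ↔ σ.var 2 ≠ 0 ∨ {z | S z}.ncard ≤ k ∧ ∀ z < n, S z → σ₂.arr 5 z ≠ 0 := by
    rw [← k7]
    by_cases h7 : σ₃.var 7 = 0
    · simp [whenF, Expr.eval, h7, k2]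
    · by_cases hk : {z | S z}.ncard ≤ k
      · have : ¬ 1 - ({z | S z}.ncard - k) = 0 := by lia
        simp [whenF, Expr.eval, h7, k6, k1, hk, assignF]
      · have : 1 - ({z | S z}.ncard - k) = 0 := by lia
        simp [whenF, Expr.eval, h7, k6, k1, this, hk, k2]
  rw [key]
  refine ⟨Or.imp_right fun H => ⟨S, hS, H.1, fun z hzn hSz => E.2 z hzn (H.2 z hzn hSz)⟩,
    Or.imp_right ?_⟩
  rintro ⟨S', hS', hk, H⟩
  obtain rfl := hS.unique hS'
  exact ⟨hk, fun z hzn hSz => E.1 z (H z hzn hSz)⟩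

end RAM

/-! ### Bipartite graphs and odd cycles -/

section Bipartite

variable {V : Type*} {G : SimpleGraph V}

/-- A shortest closed walk of odd length is an induced cycle: a repeated vertex or a chord would
split it and produce a shorter odd closed walk. -/
theorem exists_induced_odd_cycle (hG : ¬ G.Colorable 2) :
    ∃ m, 1 ≤ m ∧ cycleGraph (2 * m + 1) ⊴ G := by
  classical
  have hex : ∃ L, ∃ (u : V) (w : G.Walk u u), Odd w.length ∧ w.length = L := by
    rw [two_colorable_iff_forall_loop_even] at hG
    push Not at hG
    obtain ⟨u, w, hw⟩ := hG
    exact ⟨_, u, w, by simpa using hw, rfl⟩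
  obtain ⟨u, w, hodd, hL⟩ := Nat.find_spec hex
  have hmin : ∀ (x : V) (q : G.Walk x x), Odd q.length → w.length ≤ q.length := fun x q hq => by
    rw [hL]
    exact Nat.find_min' hex ⟨x, q, hq, rfl⟩
  clear hL
  obtain ⟨m, hm⟩ := hodd
  have hm1 : 1 ≤ m := by
    by_contra h
    have h1 := w.adj_getVert_succ (i := 0) (by lia)
    have h2 := w.getVert_of_length_le (i := 0 + 1) (by lia)
    rw [w.getVert_zero, h2] at h1
    exact G.irrefl h1
  have inner : ∀ i j, i < j → j < w.length →
      ∃ q : G.Walk (w.getVert i) (w.getVert j), q.length = j - i := fun i j hij hj =>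
    ⟨((w.drop i).take (j - i)).copy rfl (by rw [Walk.drop_getVert]; congr 1; lia), by simp; lia⟩
  have outer : ∀ i j, i < j → j < w.length →
      ∃ q : G.Walk (w.getVert j) (w.getVert i), q.length = w.length - (j - i) := fun i j hij hj =>
    ⟨(w.drop j).append (w.take i), by simp; lia⟩
  -- At a repetition the walk falls into two closed walks whose lengths add up to an odd number, so
  -- one of them is odd and shorter.
  have hinj : ∀ i j, i < j → j < w.length → w.getVert i ≠ w.getVert j := by
    intro i j hij hj he
    obtain ⟨q, hq⟩ := inner i j hij hj
    obtain ⟨q', hq'⟩ := outer i j hij hj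
    rcases Nat.even_or_odd (j - i) with hp | hp
    · have := hmin _ (q'.copy he.symm rfl) (by
        rw [Walk.length_copy, hq']
        exact Nat.Odd.sub_even (by lia) ⟨m, hm⟩ hp)
      rw [Walk.length_copy] at this
      lia
    · have := hmin _ (q.copy rfl he.symm) (by rwa [Walk.length_copy, hq])
      rw [Walk.length_copy] at this
      lia
  -- A chord closes up both arcs. The arc of even length together with the chord is odd, and it is
  -- shorter than the walk unless the other arc is a single edge.
  have hchord : ∀ i j, i < j → j < w.length → (G.Adj (w.getVert i) (w.getVert j) ↔
      j - i = 1 ∨ w.length - (j - i) = 1) := by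
    intro i j hij hj
    constructor
    · intro ha
      by_contra hne
      obtain ⟨q, hq⟩ := inner i j hij hj
      obtain ⟨q', hq'⟩ := outer i j hij hj
      rcases Nat.even_or_odd (j - i) with hp | hp
      · have := hmin _ (Walk.cons ha.symm q) (by
          rw [Walk.length_cons, hq]
          exact hp.add_one)
        rw [Walk.length_cons] at this
        lia
      · have := hmin _ (Walk.cons ha q') (by
          rw [Walk.length_cons, hq']
          exact (Nat.Odd.sub_odd ⟨m, hm⟩ hp).add_one)
        rw [Walk.length_cons] at this
        lia
    · rintro (h | h)
      · have := w.adj_getVert_succ (i := i) (by lia)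
        rwa [show i + 1 = j by lia] at this
      · have := w.adj_getVert_succ (i := j) (by lia)
        rw [show j + 1 = w.length by lia, Walk.getVert_length] at this
        rw [show i = 0 by lia, Walk.getVert_zero]
        exact this.symm
  have hadj : ∀ i j : Fin (2 * m + 1), i < j →
      (G.Adj (w.getVert i) (w.getVert j) ↔ (cycleGraph (2 * m + 1)).Adj i j) := by
    intro i j hij
    rw [hchord i j hij (by rw [hm]; exact j.2), cycleGraph_adj', Fin.sub_val_of_le hij.le,
      Fin.coe_sub_iff_lt.2 hij, hm, or_comm]
    have := j.2
    have : (i : ℕ) < j := hij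
    refine or_congr_left ?_
    lia
  refine ⟨m, hm1, ⟨⟨⟨fun i => w.getVert i, fun i j he => ?_⟩, fun {i j} => ?_⟩⟩⟩
  · rcases lt_trichotomy i j with h | h | h
    · exact absurd he (hinj i j h (by rw [hm]; exact j.2))
    · exact h
    · exact absurd he.symm (hinj j i h (by rw [hm]; exact i.2))
  · rcases lt_trichotomy i j with h | h | h
    · exact hadj i j h
    · subst h
      exact iff_of_false (G.irrefl) (SimpleGraph.irrefl _)
    · rw [(cycleGraph _).adj_comm, ← hadj j i h]
      exact G.adj_comm _ _

theorem isOddCycleTransversal_iff {S : Finset V} :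
    IsOddCycleTransversal G S ↔ (G.induce {v | v ∉ S}).Colorable 2 := by
  constructor
  · intro h
    by_contra hc
    obtain ⟨m, hm, hC⟩ := exists_induced_odd_cycle hc
    exact h m hm hC
  · rintro hc m hm ⟨f⟩
    have h2 := (hc.of_hom f.toHom).chromaticNumber_le
    rw [chromaticNumber_cycleGraph_of_odd _ (by lia) ⟨m, rfl⟩] at h2
    exact absurd h2 (by decide)

/-- The complement of the union of two independent sets is an odd cycle transversal, and so are its
supersets. -/
theorem isOddCycleTransversal_of_isIndepSet {S : Finset V} {I J : Set V} (hI : G.IsIndepSet I)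
    (hJ : G.IsIndepSet J) (h : ∀ v, v ∉ S → v ∈ I ∨ v ∈ J) : IsOddCycleTransversal G S := by
  classical
  rw [isOddCycleTransversal_iff]
  refine ⟨Coloring.mk (fun v => if v.1 ∈ I then 0 else 1) fun {u v} huv he => ?_⟩
  have huv' : G.Adj u.1 v.1 := huv
  have hu := h u.1 u.2
  have hv := h v.1 v.2
  by_cases h1 : u.1 ∈ I <;> by_cases h2 : v.1 ∈ I
  · exact hI h1 h2 huv'.ne huv'
  · simp [h1, h2] at he
  · simp [h1, h2] at he
  · exact hJ (hu.resolve_left h1) (hv.resolve_left h2) huv'.ne huv'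

theorem exists_maximal_isIndepSet [Finite V] {I : Set V} (hI : G.IsIndepSet I) :
    ∃ J, I ⊆ J ∧ G.IsIndepSet J ∧ ∀ x, x ∉ J → ∃ y ∈ J, G.Adj y x := by
  obtain ⟨J, hIJ, hJ⟩ := (Set.toFinite {J : Set V | G.IsIndepSet J}).exists_le_maximal hI
  refine ⟨J, hIJ, hJ.prop, fun x hx => ?_⟩
  by_contra! hne
  have : G.IsIndepSet (insert x J) := by
    intro a ha b hb hab h
    rcases ha with rfl | ha <;> rcases hb with rfl | hb
    · exact hab rfl
    · exact hne b hb h.symm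
    · exact hne a ha h
    · exact hJ.prop ha hb hab h
  exact hx (hJ.le_of_ge this (Set.subset_insert x J) (Set.mem_insert x J))

/-- The colour classes of `G - S` are enlarged to maximal independent sets of `G`. These may overlap
and may meet `S`, which only shrinks the complement of their union. -/
theorem IsOddCycleTransversal.exists_isIndepSet [Finite V] {S : Finset V}
    (h : IsOddCycleTransversal G S) : ∃ I J : Set V,
      (G.IsIndepSet I ∧ ∀ x, x ∉ I → ∃ y ∈ I, G.Adj y x) ∧
      (G.IsIndepSet J ∧ ∀ x, x ∉ J → ∃ y ∈ J, G.Adj y x) ∧ ∀ v, v ∉ S → v ∈ I ∨ v ∈ J := by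
  rw [isOddCycleTransversal_iff] at h
  obtain ⟨c⟩ := h
  have hc : ∀ i : Fin 2, G.IsIndepSet {v | ∃ hv : v ∉ S, c ⟨v, hv⟩ = i} := by
    rintro i a ⟨ha, ha'⟩ b ⟨hb, hb'⟩ - hab
    exact c.valid (v := ⟨a, ha⟩) (w := ⟨b, hb⟩) hab (ha'.trans hb'.symm)
  obtain ⟨I, hI, hI'⟩ := exists_maximal_isIndepSet (hc 0)
  obtain ⟨J, hJ, hJ'⟩ := exists_maximal_isIndepSet (hc 1)
  refine ⟨I, J, hI', hJ', fun v hv => ?_⟩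
  rcases (by lia : c ⟨v, hv⟩ = 0 ∨ c ⟨v, hv⟩ = 1) with h | h
  · exact Or.inl (hI ⟨hv, h⟩)
  · exact Or.inr (hJ ⟨hv, h⟩)

end Bipartite

/-! ### Induced matchings -/

section Matching

variable {V : Type*} {G : SimpleGraph V}

/-- `G` has an induced matching with `s` edges and all vertices in `R`. -/
def HasInducedMatching (G : SimpleGraph V) (R : Set V) (s : ℕ) : Prop :=
  ∃ a b : Fin s → V, (∀ i, a i ∈ R ∧ b i ∈ R ∧ G.Adj (a i) (b i)) ∧
    ∀ i j, i ≠ j → ¬ G.Adj (a i) (a j) ∧ ¬ G.Adj (a i) (b j) ∧ ¬ G.Adj (b i) (b j)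

/-- An induced matching is not required to have distinct ends, so injectivity has to be derived:
vertices with the same image have the same neighbours, hence lie in the same edge, and the ends of
an edge differ. -/
theorem IsSP2Free.not_hasInducedMatching {s : ℕ} (h : IsSP2Free s G) (R : Set V) :
    ¬ HasInducedMatching G R s := by
  rintro ⟨a, b, h1, h2⟩
  have hadj : ∀ x y : Fin s × Fin 2, G.Adj (if x.2 = 0 then a x.1 else b x.1)
      (if y.2 = 0 then a y.1 else b y.1) ↔ (disjointCopies s (pathGraph 2)).Adj x y := by
    rintro ⟨i, e⟩ ⟨j, f⟩
    simp only [disjointCopies, pathGraph_adj]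
    by_cases hij : i = j
    · subst hij
      have := (h1 i).2.2
      fin_cases e <;> fin_cases f <;> simp [this, this.symm]
    · simp only [hij, false_and, iff_false]
      have h3 := h2 i j hij
      have h4 := h2 j i (Ne.symm hij)
      split_ifs
      · exact h3.1
      · exact h3.2.1
      · exact fun h => h4.2.1 h.symm
      · exact h3.2.2
  refine h ⟨⟨⟨fun x => if x.2 = 0 then a x.1 else b x.1, fun x y he => ?_⟩, fun {x y} => hadj x y⟩⟩
  obtain ⟨i, e⟩ := x
  have h3 : ∀ f, (disjointCopies s (pathGraph 2)).Adj (i, f) (i, e) ↔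
      (disjointCopies s (pathGraph 2)).Adj (i, f) y := fun f => by
    rw [← hadj, ← hadj]
    simp only at he
    rw [he]
  obtain ⟨j, f⟩ := y
  simp only [disjointCopies, pathGraph_adj, true_and] at h3
  -- In `Fin 2`, `e + 1` is the other end of the edge.
  have h4 := h3 (e + 1)
  have h5 : i = j := by
    by_contra hij
    simp only [hij, false_and, iff_false] at h4
    fin_cases e <;> simp at h4
  subst h5
  simp only [true_and] at h4
  fin_cases e <;> fin_cases f <;> simp_all

theorem HasInducedMatching.cons {R R' : Set V} {s : ℕ} (h : HasInducedMatching G R' s)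
    (hR : R' ⊆ R) {u v : V} (hu : u ∈ R) (hv : v ∈ R) (huv : G.Adj u v)
    (h' : ∀ x ∈ R', ¬ G.Adj u x ∧ ¬ G.Adj v x) : HasInducedMatching G R (s + 1) := by
  obtain ⟨a, b, h1, h2⟩ := h
  refine ⟨Fin.cons u a, Fin.cons v b, fun i => ?_, fun i j => ?_⟩
  · refine Fin.cases ⟨hu, hv, huv⟩ (fun i => ?_) i
    exact ⟨hR (h1 i).1, hR (h1 i).2.1, (h1 i).2.2⟩
  · refine Fin.cases (Fin.cases (fun h => absurd rfl h) (fun j _ => ?_) j)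
      (fun i => Fin.cases (fun _ => ?_) (fun j hij => ?_) j) i
    · exact ⟨(h' _ (h1 j).1).1, (h' _ (h1 j).2.1).1, (h' _ (h1 j).2.1).2⟩
    · exact ⟨fun h => (h' _ (h1 i).1).1 h.symm, fun h => (h' _ (h1 i).1).2 h.symm,
        fun h => (h' _ (h1 i).2.1).2 h.symm⟩
    · exact h2 i j fun h => hij (congrArg _ h)

/-- A maximal independent set of a graph without large induced matchings is a greedy independent set
of the vertices without conflicts with the pairs in a short list. -/
theorem exists_conflict_list [LinearOrder V] [Finite V] (s : ℕ) :
    ∀ R I : Set V, I ⊆ R → G.IsIndepSet I → (∀ x ∈ R, x ∉ I → ∃ y ∈ I, G.Adj y x) →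
      ¬ HasInducedMatching G R s → ∃ P : List (V × V), P.length < s ∧ (∀ c ∈ P, c.2 ∈ R) ∧
        ∀ x ∈ R, x ∈ I ↔ (∀ y < x, y ∈ I → ¬ G.Adj y x) ∧
          ∀ c ∈ P, ¬ (x < c.2 ∧ (x = c.1 ∨ G.Adj x c.1 ∨ G.Adj x c.2)) := by
  induction s with
  | zero => exact fun R I _ _ _ h => absurd ⟨Fin.elim0, Fin.elim0, fun i => i.elim0,
      fun i => i.elim0⟩ h
  | succ s ih =>
    intro R I hIR hI hmax hfree
    have hI' : ∀ x ∈ I, ∀ y ∈ I, ¬ G.Adj x y := fun x hx y hy h => hI hx hy h.ne h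
    -- The vertices of `I` that come too late: `v` is the first neighbour in `I` of some smaller `u
    -- ∉ I`, which the plain scan would not exclude.
    let B : Set V := {v | v ∈ I ∧ ∃ u ∈ R, u ∉ I ∧ u < v ∧ G.Adj v u ∧ ∀ y ∈ I, G.Adj y u → v ≤ y}
    have hB : ∀ u ∈ R, u ∉ I → (∀ y < u, y ∈ I → ¬ G.Adj y u) → ∃ v ∈ B, G.Adj v u ∧ u < v := by
      intro u hu huI hno
      obtain ⟨v, ⟨hv, hvu⟩, hmin⟩ := Set.exists_min_image {y | y ∈ I ∧ G.Adj y u} id (Set.toFinite _)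
        (by obtain ⟨y, hy⟩ := hmax u hu huI; exact ⟨y, hy⟩)
      have huv : u < v := lt_of_le_of_ne (not_lt.1 fun h => hno v h hv hvu) hvu.ne'
      exact ⟨v, ⟨hv, u, hu, huI, huv, hvu, fun y hy hyu => hmin y ⟨hy, hyu⟩⟩, hvu, huv⟩
    by_cases hne : B.Nonempty
    · obtain ⟨v, ⟨hv, u, hu, huI, huv, hvu, hvmin⟩, hvmax⟩ :=
        Set.exists_max_image B id (Set.toFinite _) hne
      -- Everything below `v` that the pair `(u, v)` does not forbid. No vertex of `I` below `v` is
      -- lost, since `v` is the first neighbour of `u` in `I`.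
      let R' : Set V := {x | x ∈ R ∧ x < v ∧ x ≠ u ∧ ¬ G.Adj x u ∧ ¬ G.Adj x v}
      have hIR' : ∀ x ∈ I, x < v → x ∈ R' := fun x hx hxv =>
        ⟨hIR hx, hxv, fun h => huI (h ▸ hx), fun h => absurd (hvmin x hx h) (not_le.2 hxv),
          hI' x hx v hv⟩
      obtain ⟨P, hP, hPR, hPI⟩ := ih R' (I ∩ R') Set.inter_subset_right
        (fun a ha b hb => hI ha.1 hb.1) (by
          intro x hx hxI
          have hxI' : x ∉ I := fun h => hxI ⟨h, hx⟩
          -- Maximality passes to `R'`: the first neighbour of `x` in `I` is below `x` or lies in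
          -- `B`, hence is at most `v` by the choice of `v`, and it is not `v`.
          have : ∃ y ∈ I, G.Adj y x ∧ y ≤ v := by
            by_cases hno : ∀ y < x, y ∈ I → ¬ G.Adj y x
            · obtain ⟨y, hy, hyx, -⟩ := hB x hx.1 hxI' hno
              exact ⟨y, hy.1, hyx, hvmax y hy⟩
            · push Not at hno
              obtain ⟨y, hyx, hy, ha⟩ := hno
              exact ⟨y, hy, ha, (hyx.trans hx.2.1).le⟩
          obtain ⟨y, hy, hyx, hyv⟩ := this
          have hyv' : y < v := lt_of_le_of_ne hyv fun h => hx.2.2.2.2 (h ▸ hyx.symm)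
          exact ⟨y, ⟨hy, hIR' y hy hyv'⟩, hyx⟩)
        (fun h => hfree (h.cons (fun x hx => hx.1) hu (hIR hv) hvu.symm fun x hx =>
          ⟨fun h => hx.2.2.2.1 h.symm, fun h => hx.2.2.2.2 h.symm⟩))
      refine ⟨(u, v) :: P, by simpa using hP, ?_, fun x hx => ?_⟩
      · simpa [hIR hv] using fun a b hab => (hPR (a, b) hab).1
      · rw [List.forall_mem_cons]
        constructor
        · intro hxI
          refine ⟨fun y _ hy => hI' y hy x hxI, ?_, fun c hc hcx => ?_⟩
          · rintro ⟨hxv, h⟩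
            have := hIR' x hxI hxv
            rcases h with h | h | h
            · exact this.2.2.1 h
            · exact this.2.2.2.1 h
            · exact this.2.2.2.2 h
          · have hxR := hIR' x hxI (hcx.1.trans (hPR c hc).2.1)
            exact ((hPI x hxR).1 ⟨hxI, hxR⟩).2 c hc hcx
        · rintro ⟨hno, h1, h2⟩
          by_contra hxI
          -- An excluded vertex that the plain scan misses lies below some element of `B`, hence
          -- below `v`, where the recursion applies.
          obtain ⟨w, hw, hwx, hxw⟩ := hB x hx hxI hno
          have hxv : x < v := hxw.trans_le (hvmax w hw)
          have hxR : x ∈ R' := ⟨hx, hxv, fun h => h1 ⟨hxv, Or.inl h⟩,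
            fun h => h1 ⟨hxv, Or.inr (Or.inl h)⟩, fun h => h1 ⟨hxv, Or.inr (Or.inr h)⟩⟩
          exact hxI ((hPI x hxR).2 ⟨fun y hy hyI => hno y hy hyI.1, h2⟩).1
    · refine ⟨[], by simp, by simp, fun x hx => ⟨fun hxI => ⟨fun y _ hy => hI' y hy x hxI, by simp⟩,
        fun h => ?_⟩⟩
      by_contra hxI
      obtain ⟨v, hv, -⟩ := hB x hx hxI h.1
      exact hne ⟨v, hv⟩

/-! ### Connecting a set of vertices -/

theorem reachable_induce_of_walk {X : Set V} {u v : V} (p : G.Walk u v) (hp : ∀ x ∈ p.support, x ∈ X)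
    {w : V} (hw : w ∈ p.support) :
    (G.induce X).Reachable ⟨u, hp u p.start_mem_support⟩ ⟨w, hp w hw⟩ := by
  classical
  exact ⟨(p.takeUntil w hw).induce X fun x hx => hp x (p.support_takeUntil_subset_support hw hx)⟩

/-- Vertices two or more apart on a shortest walk are not adjacent, so every third edge of it
belongs to an induced matching. -/
theorem exists_short_walk {s : ℕ} (h : ¬ HasInducedMatching G Set.univ s) {u v : V}
    (huv : G.Reachable u v) : ∃ p : G.Walk u v, p.length < 3 * s := by
  obtain ⟨p, hp⟩ := huv.exists_walk_length_eq_dist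
  refine ⟨p, ?_⟩
  by_contra! hlen
  have hfar : ∀ i j, i + 2 ≤ j → j ≤ p.length → ¬ G.Adj (p.getVert i) (p.getVert j) := by
    intro i j hij hj ha
    have := dist_le ((p.take i).append (Walk.cons ha (p.drop j)))
    simp at this
    lia
  refine h ⟨fun i => p.getVert (3 * i), fun i => p.getVert (3 * i + 1), fun i => ⟨trivial, trivial,
    p.adj_getVert_succ (by lia)⟩, fun i j hij => ?_⟩
  rcases lt_or_gt_of_ne hij with hij | hij
  · have : (i : ℕ) < j := hij
    exact ⟨hfar _ _ (by lia) (by lia), hfar _ _ (by lia) (by lia), hfar _ _ (by lia) (by lia)⟩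
  · have : (j : ℕ) < i := hij
    exact ⟨fun h => hfar _ _ (by lia) (by lia) h.symm, fun h => hfar _ _ (by lia) (by lia) h.symm,
      fun h => hfar _ _ (by lia) (by lia) h.symm⟩

/-- If an independent set dominates another one, then few of its vertices do so. -/
theorem exists_dominating_finset [Finite V] {s : ℕ} (h : ¬ HasInducedMatching G Set.univ s)
    {I C : Set V} (hI : G.IsIndepSet I) (hC : G.IsIndepSet C)
    (hdom : ∀ x ∈ C, ∃ y ∈ I, G.Adj x y) :
    ∃ F : Finset V, F.card < s ∧ (F : Set V) ⊆ I ∧ ∀ x ∈ C, ∃ y ∈ F, G.Adj x y := by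
  classical
  have := Fintype.ofFinite V
  obtain ⟨F, hF⟩ := (Set.toFinite {F : Finset V | (F : Set V) ⊆ I ∧
    ∀ x ∈ C, ∃ y ∈ F, G.Adj x y}).exists_minimal ⟨(Set.toFinite I).toFinset, by
      simpa using hdom⟩
  refine ⟨F, ?_, hF.prop⟩
  by_contra! hcard
  -- By minimality each `y ∈ F` has a private neighbour in `C`. As both sides are independent, these
  -- edges form an induced matching.
  have hpriv : ∀ y ∈ F, ∃ c ∈ C, G.Adj c y ∧ ∀ z ∈ F, G.Adj c z → z = y := by
    intro y hy
    by_contra! hne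
    have := hF.le_of_le (y := F.erase y) ⟨fun z hz => hF.prop.1 (Finset.erase_subset _ _ hz), fun x hx => by
      obtain ⟨z, hz, hxz⟩ := hF.prop.2 x hx
      by_cases hzy : z = y
      · obtain ⟨z', h1, h2, h3⟩ := hne x hx (hzy ▸ hxz)
        exact ⟨z', Finset.mem_erase.2 ⟨h3, h1⟩, h2⟩
      · exact ⟨z, Finset.mem_erase.2 ⟨hzy, hz⟩, hxz⟩⟩ (Finset.erase_subset _ _)
    exact Finset.notMem_erase y F (this hy)
  choose! c hcC hcy hcu using hpriv
  obtain ⟨F', hF', hcard'⟩ := Finset.exists_subset_card_eq hcard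
  let e := F'.equivFinOfCardEq hcard'
  have he : ∀ i, (e.symm i : V) ∈ F := fun i => hF' (e.symm i).2
  have hne : ∀ i j, i ≠ j → (e.symm i : V) ≠ e.symm j := fun i j hij h =>
    hij (e.symm.injective (Subtype.ext h))
  refine h ⟨fun i => e.symm i, fun i => c (e.symm i), fun i => ⟨trivial, trivial,
    (hcy _ (he i)).symm⟩, fun i j hij => ⟨?_, ?_, ?_⟩⟩
  · exact fun h => hI (hF.prop.1 (he i)) (hF.prop.1 (he j)) h.ne h
  · exact fun h => hne i j hij (hcu _ (he j) _ (he i) h.symm)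
  · exact fun h => hC (hcC _ (he i)) (hcC _ (he j)) h.ne h

/-- In a graph without large induced matchings, few vertices suffice to connect a set of vertices that
is dominated by an independent set. -/
theorem exists_connecting_finset [Finite V] {s : ℕ} (h : ¬ HasInducedMatching G Set.univ s)
    {I S : Set V} (hI : G.IsIndepSet I) (hdom : ∀ x ∈ S, ∃ y ∈ I, G.Adj x y) (hS : S.Nonempty)
    (hreach : ∀ x ∈ S, ∀ y ∈ S, G.Reachable x y) :
    ∃ T : Finset V, T.card ≤ s * (3 * s) ∧ (G.induce (S ∪ T)).Connected := by
  classical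
  obtain ⟨r, hr⟩ := hS
  -- One vertex for each component of `G[S]`. Distinct representatives are not adjacent, so
  -- domination of an independent set applies.
  let rep : S → S := fun x => Quot.out ((G.induce S).connectedComponentMk x)
  have hrep : ∀ x, (G.induce S).Reachable (rep x) x := fun x =>
    ConnectedComponent.exact (Quot.out_eq _)
  have hC : G.IsIndepSet {c | ∃ x, (rep x : V) = c} := by
    rintro _ ⟨x, rfl⟩ _ ⟨y, rfl⟩ hne hadj
    have h1 : (G.induce S).Adj (rep x) (rep y) := hadj
    have h2 : (G.induce S).connectedComponentMk x = (G.induce S).connectedComponentMk y :=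
      ConnectedComponent.sound (((hrep x).symm.trans h1.reachable).trans (hrep y))
    exact hne (congrArg (fun c : (G.induce S).ConnectedComponent => ((Quot.out c : S) : V)) h2)
  obtain ⟨F, hFc, hFI, hF⟩ := exists_dominating_finset h hI hC (by
    rintro _ ⟨x, rfl⟩
    exact hdom _ (rep x).2)
  -- Fewer than `3 * s` edges means at most `3 * s` vertices. The empty set for unreachable `y`
  -- makes the bound uniform over `F`.
  have hwalk : ∀ y : V, ∃ W : Finset V, W.card ≤ 3 * s ∧ (G.Reachable r y →
      ∃ p : G.Walk r y, ∀ x, x ∈ W ↔ x ∈ p.support) ∧ (¬ G.Reachable r y → W = ∅) := by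
    intro y
    by_cases hy : G.Reachable r y
    · obtain ⟨p, hp⟩ := exists_short_walk h hy
      refine ⟨p.support.toFinset, ?_, fun _ => ⟨p, fun x => List.mem_toFinset⟩, fun h => absurd hy h⟩
      have := p.support.toFinset_card_le
      rw [Walk.length_support] at this
      lia
    · exact ⟨∅, by simp, fun h => absurd h hy, fun _ => rfl⟩
  choose W hWc hW hW' using hwalk
  refine ⟨F.biUnion W, (Finset.card_biUnion_le_card_mul _ _ _ fun y _ => hWc y).trans
    (Nat.mul_le_mul_right _ hFc.le), ?_⟩
  rw [connected_iff_exists_forall_reachable]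
  refine ⟨⟨r, Or.inl hr⟩, ?_⟩
  have hT : ∀ y ∈ F, ∀ x ∈ W y, ∀ hx, (G.induce (S ∪ ↑(F.biUnion W))).Reachable
      ⟨r, Or.inl hr⟩ ⟨x, hx⟩ := by
    intro y hy x hx hx'
    have hry : G.Reachable r y := by
      by_contra hn
      simp [hW' y hn] at hx
    obtain ⟨p, hp⟩ := hW y hry
    refine reachable_induce_of_walk p (fun z hz => Or.inr ?_) ((hp x).1 hx)
    exact Finset.mem_coe.2 (Finset.mem_biUnion.2 ⟨y, hy, (hp z).2 hz⟩)
  rintro ⟨x, hx | hx⟩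
  -- The route from `r` to `x` runs through a dominating vertex `y`, then the representative of the
  -- component of `x`, then inside that component.
  · obtain ⟨y, hy, hxy⟩ := hF _ ⟨⟨x, hx⟩, rfl⟩
    have hry : G.Reachable r y := (hreach r hr _ (rep ⟨x, hx⟩).2).trans hxy.reachable
    obtain ⟨p, hp⟩ := hW y hry
    have hyW : y ∈ W y := (hp y).2 p.end_mem_support
    have hyT : y ∈ S ∪ ↑(F.biUnion W) :=
      Or.inr (Finset.mem_coe.2 (Finset.mem_biUnion.2 ⟨y, hy, hyW⟩))
    have h1 := hT y hy y hyW hyT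
    have h2 : (G.induce (S ∪ ↑(F.biUnion W))).Adj ⟨y, hyT⟩ ⟨rep ⟨x, hx⟩, Or.inl (rep ⟨x, hx⟩).2⟩ :=
      hxy.symm
    have h3 := (hrep ⟨x, hx⟩).map
      (induceHomOfLE G (Set.subset_union_left (s := S) (t := ↑(F.biUnion W)))).toHom
    exact (h1.trans h2.reachable).trans h3
  · obtain ⟨y, hy, hxy⟩ := Finset.mem_biUnion.1 (Finset.mem_coe.1 hx)
    exact hT y hy x hxy _

end Matching

namespace RAM

variable {n : ℕ} {G : SimpleGraph (Fin n)}

/-! ### From values of variables to transversals -/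

theorem natAdj_val {u v : Fin n} : natAdj G u v ↔ G.Adj u v :=
  ⟨fun ⟨_, _, h⟩ => h, fun h => ⟨u.2, v.2, h⟩⟩

/-- This holds for every list of pairs, so that any guess yields a genuine transversal. -/
theorem IsGreedy.isIndepSet {l : List (ℕ × ℕ)} {I : ℕ → Prop} (h : IsGreedy (natAdj G) n l I) :
    G.IsIndepSet {v | I v} := by
  intro a ha b hb hab hadj
  rcases lt_or_gt_of_ne hab with hlt | hlt
  · exact ((h b b.2).1 hb).1 a hlt ha (natAdj_val.2 hadj)
  · exact ((h a a.2).1 ha).1 b hlt hb (natAdj_val.2 hadj.symm)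

theorem IsSelection.exists_transversal {s c : ℕ} {ξ : ℕ → ℕ} {S : ℕ → Prop}
    (h : IsSelection (natAdj G) n s c ξ S) : ∃ X : Finset (Fin n), IsOddCycleTransversal G X ∧
      (∀ v : Fin n, v ∈ X ↔ S v) ∧ X.card = {z | S z}.ncard := by
  classical
  obtain ⟨I, J, hI, hJ, hS⟩ := h
  refine ⟨Finset.univ.filter fun v => S v, ?_, by simp, ?_⟩
  · refine isOddCycleTransversal_of_isIndepSet hI.isIndepSet hJ.isIndepSet fun v hv => ?_
    rw [Finset.mem_filter, hS] at hv
    by_contra hIJ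
    exact hv ⟨Finset.mem_univ v, v.2, Or.inl hIJ⟩
  · rw [← Set.ncard_coe_finset, ← Set.ncard_image_of_injective _ Fin.val_injective]
    congr 1
    ext z
    constructor
    · rintro ⟨v, hv, rfl⟩
      exact (Finset.mem_filter.1 (Finset.mem_coe.1 hv)).2
    · intro hz
      exact ⟨⟨z, ((hS z).1 hz).1⟩, Finset.mem_coe.2 (Finset.mem_filter.2 ⟨Finset.mem_univ _, hz⟩), rfl⟩

theorem ReachIn.mono {R : ℕ → ℕ → Prop} {t i j z : ℕ} (h : ReachIn R t i z) (hij : i ≤ j) :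
    ReachIn R t j z := by
  induction hij with
  | refl => exact h
  | step _ ih => exact Or.inl ih

theorem ReachIn.reachable {S : ℕ → Prop} {X : Finset (Fin n)} (hX : ∀ v : Fin n, v ∈ X ↔ S v)
    {t : Fin n} (ht : t ∈ X) {j : ℕ} : ∀ {z : ℕ}, ReachIn (StepInto (natAdj G) n S) t j z →
      ∃ (hz : z < n) (hzX : ⟨z, hz⟩ ∈ X),
        (G.induce {v | v ∈ X}).Reachable ⟨t, ht⟩ ⟨⟨z, hz⟩, hzX⟩ := by
  induction j with
  | zero =>
    rintro z rfl
    exact ⟨t.2, ht, .rfl⟩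
  | succ j ih =>
    rintro z (h | ⟨y, hy, -, hz, ⟨_, _, hyz⟩, hSz⟩)
    · exact ih h
    · obtain ⟨hy, hyX, hr⟩ := ih hy
      have hzX : ⟨z, hz⟩ ∈ X := (hX _).2 hSz
      have ha : (G.induce {v | v ∈ X}).Adj ⟨⟨y, hy⟩, hyX⟩ ⟨⟨z, hz⟩, hzX⟩ := hyz
      exact ⟨hz, hzX, hr.trans ha.reachable⟩

theorem reachIn_of_reachable {S : ℕ → Prop} {X : Set (Fin n)} (hX : ∀ v : Fin n, v ∈ X ↔ S v)
    {t z : X} (h : (G.induce X).Reachable t z) :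
    ReachIn (StepInto (natAdj G) n S) t.1 n z.1 := by
  classical
  obtain ⟨p, hp⟩ := h.exists_isPath
  have key : ∀ i ≤ p.length, ReachIn (StepInto (natAdj G) n S) t.1 i (p.getVert i).1 := by
    intro i
    induction i with
    | zero => exact fun _ => by rw [Walk.getVert_zero]; rfl
    | succ i ih =>
      intro hi
      have ha : G.Adj (p.getVert i).1 (p.getVert (i + 1)).1 := p.adj_getVert_succ (by lia)
      exact Or.inr ⟨_, ih (by lia), Fin.is_lt _, Fin.is_lt _, natAdj_val.2 ha,
        (hX _).1 (p.getVert (i + 1)).2⟩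
  have hlen := hp.length_lt
  have hcard : Fintype.card X ≤ n := by
    simpa using Fintype.card_le_of_injective (fun x : X => x.1) Subtype.val_injective
  have := key p.length le_rfl
  rw [Walk.getVert_length] at this
  exact this.mono (by lia)

/-! ### From transversals to values of variables -/

/-- A short list is padded to length `s` with the pair `(0, 0)`, which conflicts with nothing
because no `x` satisfies `x < 0`. -/
theorem IsGreedy.exists_range {A : ℕ → ℕ → Prop} {l : List (ℕ × ℕ)} {I : ℕ → Prop}
    (h : IsGreedy A n l I) {s : ℕ} (hs : l.length ≤ s) (hn : 0 < n)
    (hl : ∀ c ∈ l, c.1 < n ∧ c.2 < n) :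
    ∃ ζ : ℕ → ℕ, (∀ j, ζ j < n) ∧ IsGreedy A n (pairsOf ζ 0 s) I := by
  let p : ℕ → ℕ × ℕ := fun t => l.getD t (0, 0)
  have hp : ∀ t, p t ∈ l ∨ p t = (0, 0) := by
    intro t
    by_cases ht : t < l.length
    · exact Or.inl (by rw [show p t = l[t] from List.getD_eq_getElem _ _ ht]; exact List.getElem_mem ht)
    · exact Or.inr (List.getD_eq_default _ _ (by lia))
  have hpn : ∀ t, (p t).1 < n ∧ (p t).2 < n := by
    intro t
    rcases hp t with h | h
    · exact hl _ h
    · rw [h]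
      exact ⟨hn, hn⟩
  refine ⟨fun j => if j % 2 = 0 then (p (j / 2)).1 else (p (j / 2)).2, fun j => ?_, fun x hx => ?_⟩
  · dsimp only
    split_ifs
    · exact (hpn _).1
    · exact (hpn _).2
  · rw [h x hx]
    refine and_congr_right fun _ => ?_
    have e : pairsOf (fun j => if j % 2 = 0 then (p (j / 2)).1 else (p (j / 2)).2) 0 s =
        (List.range s).map p := by
      refine List.map_congr_left fun t _ => ?_
      dsimp only
      rw [if_pos (by lia), if_neg (by lia), show (0 + 2 * t) / 2 = t by lia,
        show (0 + 2 * t + 1) / 2 = t by lia]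
    rw [e, List.forall_mem_map]
    constructor
    · intro H t _
      rcases hp t with h | h
      · exact H _ h
      · rw [h]
        exact fun h => Nat.not_lt_zero _ h.1
    · intro H c hc
      obtain ⟨t, ht, rfl⟩ := List.getElem_of_mem hc
      have := H t (List.mem_range.2 (by lia))
      rwa [show p t = l[t] from List.getD_eq_getElem _ _ ht] at this

theorem exists_isGreedy {s : ℕ} (hG : IsSP2Free s G) (hn : 0 < n) {I : Set (Fin n)}
    (hI : G.IsIndepSet I) (hmax : ∀ x, x ∉ I → ∃ y ∈ I, G.Adj y x) :
    ∃ ζ : ℕ → ℕ, (∀ j, ζ j < n) ∧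
      IsGreedy (natAdj G) n (pairsOf ζ 0 s) fun z => ∃ h : z < n, ⟨z, h⟩ ∈ I := by
  obtain ⟨P, hP, -, hPI⟩ := exists_conflict_list s Set.univ I (Set.subset_univ _) hI
    (fun x _ => hmax x) (hG.not_hasInducedMatching _)
  refine IsGreedy.exists_range (l := P.map fun c => (c.1.1, c.2.1)) (fun x hx => ?_)
    (by simpa using hP.le) hn ?_
  · have key := hPI ⟨x, hx⟩ trivial
    rw [List.forall_mem_map]
    constructor
    · rintro ⟨_, hxI⟩
      obtain ⟨h1, h2⟩ := key.1 hxI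
      refine ⟨?_, fun c hc => ?_⟩
      · rintro y hyx ⟨hy, hyI⟩ ⟨_, _, ha⟩
        exact h1 ⟨y, hy⟩ hyx hyI ha
      · rintro ⟨hlt, h⟩
        refine h2 c hc ⟨hlt, ?_⟩
        rcases h with h | ⟨_, _, h⟩ | ⟨_, _, h⟩
        · exact Or.inl (Fin.ext h)
        · exact Or.inr (Or.inl h)
        · exact Or.inr (Or.inr h)
    · rintro ⟨h1, h2⟩
      refine ⟨hx, key.2 ⟨fun y hyx hyI ha => h1 y hyx ⟨y.2, hyI⟩ ⟨y.2, hx, ha⟩, fun c hc => ?_⟩⟩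
      rintro ⟨hlt, h⟩
      refine h2 c hc ⟨hlt, ?_⟩
      rcases h with h | h | h
      · exact Or.inl (congrArg Fin.val h)
      · exact Or.inr (Or.inl ⟨hx, c.1.2, h⟩)
      · exact Or.inr (Or.inr ⟨hx, c.2.2, h⟩)
  · intro c hc
    obtain ⟨d, -, rfl⟩ := List.mem_map.1 hc
    exact ⟨d.1.2, d.2.2⟩

theorem exists_isSelection {s : ℕ} (hG : IsSP2Free s G) (hn : 0 < n) {I J : Set (Fin n)}
    (hI : G.IsIndepSet I ∧ ∀ x, x ∉ I → ∃ y ∈ I, G.Adj y x)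
    (hJ : G.IsIndepSet J ∧ ∀ x, x ∉ J → ∃ y ∈ J, G.Adj y x) (c : ℕ) (T : ℕ → ℕ)
    (hT : ∀ j, T j < n) : ∃ ξ : ℕ → ℕ, (∀ j < 4 * s + c, ξ j < n) ∧
      (∀ j, 4 * s + c ≤ j → ξ j = 0) ∧ (∀ j < c, ξ (4 * s + j) = T j) ∧
      IsSelection (natAdj G) n s c ξ fun z => z < n ∧
        (¬ ((∃ h : z < n, ⟨z, h⟩ ∈ I) ∨ ∃ h : z < n, ⟨z, h⟩ ∈ J) ∨ ∃ j < c, z = T j) := by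
  obtain ⟨ζ, hζ, hζI⟩ := exists_isGreedy hG hn hI.1 hI.2
  obtain ⟨η, hη, hηJ⟩ := exists_isGreedy hG hn hJ.1 hJ.2
  -- Layout of the guess: `2 * s` entries for `I`, `2 * s` for `J`, `c` added vertices, then zeros.
  let ξ : ℕ → ℕ := fun j => if j < 2 * s then ζ j else if j < 4 * s then η (j - 2 * s) else
    if j < 4 * s + c then T (j - 4 * s) else 0
  have h1 : ∀ j < 2 * s, ξ j = ζ j := fun j hj => if_pos hj
  have h2 : ∀ j < 2 * s, ξ (2 * s + j) = η j := fun j hj => by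
    simp only [ξ]
    rw [if_neg (by lia), if_pos (by lia), Nat.add_sub_cancel_left]
  have h3 : ∀ j < c, ξ (4 * s + j) = T j := fun j hj => by
    simp only [ξ]
    rw [if_neg (by lia), if_neg (by lia), if_pos (by lia), Nat.add_sub_cancel_left]
  refine ⟨ξ, fun j _ => ?_, fun j hj => ?_, h3, fun z => ∃ h : z < n, ⟨z, h⟩ ∈ I,
    fun z => ∃ h : z < n, ⟨z, h⟩ ∈ J, ?_, ?_, fun z => ?_⟩
  · simp only [ξ]
    split_ifs
    exacts [hζ _, hη _, hT _]
  · exact (if_neg (by lia)).trans ((if_neg (by lia)).trans (if_neg (by lia)))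
  · have e : pairsOf ξ 0 s = pairsOf ζ 0 s := by
      refine List.map_congr_left fun t ht => ?_
      rw [List.mem_range] at ht
      rw [h1 _ (by lia), h1 _ (by lia)]
    rwa [e]
  · have e : pairsOf ξ (2 * s) s = pairsOf η 0 s := by
      refine List.map_congr_left fun t ht => ?_
      rw [List.mem_range] at ht
      rw [h2 _ (by lia), add_assoc, h2 _ (by lia), zero_add]
    rwa [e]
  · refine and_congr_right fun _ => or_congr_right (exists_congr fun j => and_congr_right fun hj => ?_)
    rw [h3 j hj]

theorem exists_connecting_of_isOddCycleTransversal {s : ℕ} (hG : IsSP2Free s G)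
    {X : Finset (Fin n)} (hX : (G.induce {v | v ∈ X}).Connected) {I J : Set (Fin n)}
    (hI : G.IsIndepSet I ∧ ∀ x, x ∉ I → ∃ y ∈ I, G.Adj y x) (hIJ : ∀ v, v ∉ X → v ∈ I ∨ v ∈ J) :
    ∃ T : Finset (Fin n), T.Nonempty ∧ T.card ≤ s * (3 * s) + 1 ∧
      (G.induce ({v | ¬ (v ∈ I ∨ v ∈ J)} ∪ ↑T)).Connected ∧
      ({v | ¬ (v ∈ I ∨ v ∈ J)} ∪ (T : Set (Fin n))).ncard ≤ X.card := by
  classical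
  set S : Set (Fin n) := {v | ¬ (v ∈ I ∨ v ∈ J)} with hS
  have hSX : S ⊆ X := fun v hv => by
    by_contra h
    exact hv (hIJ v h)
  by_cases hne : S.Nonempty
  · obtain ⟨T₁, hT₁, hc₁⟩ := exists_connecting_finset (S := S) (hG.not_hasInducedMatching _) hI.1
      (fun x hx => by
        obtain ⟨y, hy, hyx⟩ := hI.2 x fun h => hx (Or.inl h)
        exact ⟨y, hy, hyx.symm⟩) hne (fun x hx y hy =>
        (hX.preconnected ⟨x, hSX hx⟩ ⟨y, hSX hy⟩).map (Embedding.induce _).toHom)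
    obtain ⟨r, hr⟩ := hne
    have hu : S ∪ (X.filter (· ∉ S) : Finset (Fin n)) = (X : Set (Fin n)) := by
      ext v
      by_cases hv : v ∈ S
      · simp [hv, Finset.mem_coe.1 (hSX hv)]
      · simp [hv]
    have hXc : X.card = S.ncard + (X.filter (· ∉ S)).card := by
      rw [← Set.ncard_coe_finset, ← Set.ncard_coe_finset, ← hu, Set.ncard_union_eq]
      rw [Set.disjoint_left]
      intro v hv hv'
      exact (Finset.mem_filter.1 (Finset.mem_coe.1 hv')).2 hv
    have key : ∃ T : Finset (Fin n), T.card ≤ s * (3 * s) ∧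
        (G.induce (S ∪ ↑T)).Connected ∧ (S ∪ (T : Set (Fin n))).ncard ≤ X.card := by
      -- If `T₁` is no larger than `X \ S`, adding it to `S` respects the size of `X`. Otherwise `X
      -- \ S` is itself smaller than the bound on `T₁` and completes `S` to the connected set `X`.
      by_cases hle : T₁.card ≤ (X.filter (· ∉ S)).card
      · refine ⟨T₁, hT₁, hc₁, (Set.ncard_union_le _ _).trans ?_⟩
        rw [Set.ncard_coe_finset, hXc]
        lia
      · refine ⟨X.filter (· ∉ S), by lia, ?_, ?_⟩
        · rw [hu]
          exact hX
        · rw [hu, Set.ncard_coe_finset]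
    obtain ⟨T, h1, h2, h3⟩ := key
    -- Adding `r ∈ S` leaves the union unchanged and makes `T` nonempty, as the reachability search
    -- starts from a vertex of `T`.
    have e : S ∪ ((insert r T : Finset (Fin n)) : Set (Fin n)) = S ∪ T := by
      rw [Finset.coe_insert, Set.union_insert, Set.insert_eq_of_mem (Set.mem_union_left _ hr)]
    refine ⟨insert r T, Finset.insert_nonempty _ _, (Finset.card_insert_le _ _).trans (by lia), ?_, ?_⟩
    · rwa [e]
    · rwa [e]
  · rw [Set.not_nonempty_iff_eq_empty.1 hne]
    obtain ⟨v, hv⟩ := hX.nonempty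
    refine ⟨{v}, Finset.singleton_nonempty v, by simp, ?_, ?_⟩
    · rw [Set.empty_union, Finset.coe_singleton, connected_iff_exists_forall_reachable]
      refine ⟨⟨v, rfl⟩, ?_⟩
      rintro ⟨w, rfl⟩
      exact .rfl
    · simpa using Finset.card_pos.2 ⟨v, hv⟩

end RAM

/-! ### The two decision problems -/

open RAM

theorem oddCycleTransversal_polyTimeSolvableOn (s : ℕ) :
    PolyTimeSolvableOn (fun _ G => IsSP2Free s G) OddCycleTransversal := by
  refine polyTimeSolvableOn_of_guessF (polyComputes_checkF s)
    -- The preset is nonzero exactly for `n ≤ k`, when the set of all vertices is a solution. In the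
    -- remaining case `0 < n`, so values for the guessed variables exist.
    (.sub (.lit 1) (.sub (.var 0) (.var 1))) (4 * s)
    (fun n G k ξ => ∃ S, IsSelection (natAdj G) n s 0 ξ S ∧ {z | S z}.ncard ≤ k)
    (fun n G k ξ => ∃ S, IsSelection (natAdj G) n s 0 ξ S ∧ {z | S z}.ncard ≤ k)
    (fun n G k σ _ h hσ => ⟨(h.checkF_var hσ).1, (h.checkF_var hσ).2⟩) ?_ ?_ ?_
  · intro n G k σ _ h he
    simp only [Expr.eval, h.var_zero, h.var_one] at he
    refine ⟨Finset.univ, ?_, by simp; lia⟩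
    rw [isOddCycleTransversal_iff]
    exact ⟨Coloring.mk (fun v => absurd (Finset.mem_univ v.1) v.2)
      fun {v} => absurd (Finset.mem_univ v.1) v.2⟩
  · rintro n G k ξ _ _ ⟨S, hS, hk⟩
    obtain ⟨X, hX, -, hc⟩ := hS.exists_transversal
    exact ⟨X, hX, hc.trans_le hk⟩
  · rintro n G k σ hG ⟨X, hX, hk⟩ h
    simp only [Expr.eval, h.var_zero, h.var_one]
    by_cases hnk : n ≤ k
    · exact Or.inl (by lia)
    · obtain ⟨I, J, hI, hJ, hIJ⟩ := hX.exists_isIndepSet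
      obtain ⟨ξ, h1, h2, -, h3⟩ := exists_isSelection hG (by lia) hI hJ 0 (fun _ => 0)
        fun _ => by lia
      refine Or.inr ⟨ξ, h1, h2, _, h3, le_trans ?_ hk⟩
      rw [← Set.ncard_coe_finset, ← Set.ncard_image_of_injective _ Fin.val_injective]
      refine Set.ncard_le_ncard ?_ (Set.toFinite _)
      rintro z ⟨hz, hz' | ⟨j, hj, -⟩⟩
      · refine ⟨⟨z, hz⟩, ?_, rfl⟩
        by_contra hzX
        exact hz' ((hIJ _ hzX).imp (fun h => ⟨hz, h⟩) fun h => ⟨hz, h⟩)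
      · exact absurd hj (Nat.not_lt_zero j)

theorem connectedOddCycleTransversal_polyTimeSolvableOn (s : ℕ) :
    PolyTimeSolvableOn (fun _ G => IsSP2Free s G) ConnectedOddCycleTransversal := by
  -- The bound for the connecting set, plus one for the vertex that makes it nonempty.
  set c := s * (3 * s) + 1 with hc
  refine polyTimeSolvableOn_of_guessF (polyComputes_connectedCheckF s c) (.lit 0) (4 * s + c)
    (fun n G k ξ => ∃ S, IsSelection (natAdj G) n s c ξ S ∧ {z | S z}.ncard ≤ k ∧
      ∀ z < n, S z → ∃ j, ReachIn (StepInto (natAdj G) n S) (ξ (4 * s)) j z)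
    (fun n G k ξ => ∃ S, IsSelection (natAdj G) n s c ξ S ∧ {z | S z}.ncard ≤ k ∧
      ∀ z < n, S z → ReachIn (StepInto (natAdj G) n S) (ξ (4 * s)) n z)
    (fun n G k σ _ h hσ => h.connectedCheckF_var hσ) ?_ ?_ ?_
  · intro n G k σ _ _ he
    exact absurd rfl he
  · rintro n G k ξ _ hξ ⟨S, hS, hk, hr⟩
    obtain ⟨X, hX, hXS, hcard⟩ := hS.exists_transversal
    have ht : ξ (4 * s) < n := hξ _ (by lia)
    have htX : (⟨ξ (4 * s), ht⟩ : Fin n) ∈ X := by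
      obtain ⟨I, J, -, -, hS⟩ := hS
      exact (hXS _).2 ((hS _).2 ⟨ht, Or.inr ⟨0, by lia, rfl⟩⟩)
    refine ⟨X, hX, ?_, hcard.trans_le hk⟩
    rw [connected_iff_exists_forall_reachable]
    refine ⟨⟨_, htX⟩, fun ⟨z, hz⟩ => ?_⟩
    obtain ⟨j, hj⟩ := hr z z.2 ((hXS z).1 hz)
    obtain ⟨_, _, h⟩ := ReachIn.reachable (t := ⟨ξ (4 * s), ht⟩) hXS htX hj
    exact h
  · rintro n G k σ hG ⟨X, hX, hconn, hk⟩ -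
    right
    obtain ⟨I, J, hI, hJ, hIJ⟩ := hX.exists_isIndepSet
    obtain ⟨T, ⟨t₀, ht₀⟩, hTc, hTconn, hTcard⟩ :=
      exists_connecting_of_isOddCycleTransversal hG hconn hI hIJ
    -- The elements of `T` are listed and padded with `t₀ ∈ T`, so the extra entries add nothing to
    -- the selection.
    let t : ℕ → Fin n := fun j => T.toList.getD j t₀
    have htT : ∀ j, t j ∈ T := by
      intro j
      by_cases hj : j < T.toList.length
      · rw [show t j = T.toList[j] from List.getD_eq_getElem _ _ hj]
        exact Finset.mem_toList.1 (List.getElem_mem hj)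
      · rwa [show t j = t₀ from List.getD_eq_default _ _ (by lia)]
    have hTt : ∀ v ∈ T, ∃ j < c, v = t j := by
      intro v hv
      obtain ⟨j, hj, hjv⟩ := List.getElem_of_mem (Finset.mem_toList.2 hv)
      refine ⟨j, ?_, ?_⟩
      · rw [Finset.length_toList] at hj
        lia
      · rw [← hjv]
        exact (List.getD_eq_getElem _ _ hj).symm
    obtain ⟨ξ, h1, h2, h3, h4⟩ := exists_isSelection hG t₀.pos hI hJ c (fun j => t j)
      fun j => (t j).2
    set S : ℕ → Prop := fun z => z < n ∧ (¬ ((∃ h : z < n, ⟨z, h⟩ ∈ I) ∨ ∃ h : z < n, ⟨z, h⟩ ∈ J) ∨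
      ∃ j < c, z = (t j : ℕ))
    have hmem : ∀ v : Fin n, v ∈ {v | ¬ (v ∈ I ∨ v ∈ J)} ∪ (T : Set (Fin n)) ↔ S v := by
      intro v
      have e1 : (∃ h : (v : ℕ) < n, (⟨v, h⟩ : Fin n) ∈ I) ↔ v ∈ I := ⟨fun ⟨_, h⟩ => h, fun h => ⟨v.2, h⟩⟩
      have e2 : (∃ h : (v : ℕ) < n, (⟨v, h⟩ : Fin n) ∈ J) ↔ v ∈ J := ⟨fun ⟨_, h⟩ => h, fun h => ⟨v.2, h⟩⟩
      have e3 : (∃ j < c, (v : ℕ) = t j) ↔ v ∈ T :=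
        ⟨fun ⟨j, _, h⟩ => Fin.ext h ▸ htT j, fun h => by
          obtain ⟨j, hj, h⟩ := hTt v h
          exact ⟨j, hj, congrArg _ h⟩⟩
      exact (or_congr (not_congr (or_congr e1 e2)) e3).symm.trans (and_iff_right v.2).symm
    refine ⟨ξ, h1, h2, S, h4, ?_, fun z hz hSz => ?_⟩
    · refine le_trans (le_of_eq ?_) (hTcard.trans hk)
      rw [← Set.ncard_image_of_injective _ Fin.val_injective]
      congr 1
      ext z
      constructor
      · intro hz
        exact ⟨⟨z, hz.1⟩, (hmem _).2 hz, rfl⟩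
      · rintro ⟨v, hv, rfl⟩
        exact (hmem v).1 hv
    · have e : ξ (4 * s) = t 0 := h3 0 (by lia)
      rw [e]
      exact reachIn_of_reachable hmem (hTconn.preconnected ⟨t 0, Or.inr (htT 0)⟩
        ⟨⟨z, hz⟩, (hmem _).2 hSz⟩)

theorem theorem3p7 (s : ℕ) (hs : 1 ≤ s) :
    RAM.PolyTimeSolvableOn (fun _ G => IsSP2Free s G) OddCycleTransversal ∧
      RAM.PolyTimeSolvableOn (fun _ G => IsSP2Free s G) ConnectedOddCycleTransversal :=
  ⟨oddCycleTransversal_polyTimeSolvableOn s, connectedOddCycleTransversal_polyTimeSolvableOn s⟩
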